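/- **Conventions.** Rings are associative with unit, not necessarily commutative; modules are right modules. A right module $M$ over a ring $A$ is *coherent* if it is finitely generated and the kernel of every homomorphism $A^{k}\to M$ ($k\ge 0$) is finitely generated; $A$ is *right coherent* if the right module $A_A$ is coherent. For a $\mathbb Z$-graded ring $S$, a graded right module $M$ is *graded coherent* if it is finitely generated and the kernel of every degree-preserving homomorphism $\bigoplus_{j=1}^{k}S(-d_j)\to M$ ($k\ge 0$, $d_j\in\mathbb Z$) is finitely generated; $S$ is *graded right coherent* if the graded right module $S_S$ is graded coherent. The graded ring $S$ has *finite right graded global dimension* if there is an integer $g\ge 0$ such that every graded right $S$-module $M$ has an exact sequence $0\to P_g\to\cdots\to P_0\to M\to 0$ of graded right modules and degree-preserving homomorphisms in which every $P_i$ is a projective object of the category of graded right $S$-modules. A complex is *pure* if its cohomology is concentrated in degree $0$. **Theorem.** Let $A$ be a right coherent ring and $\sigma$ an $A$-$A$-bimodule which is finitely presented as a right $A$-module and such that for every $n\ge 1$ the iterated derived tensor product $\sigma^{\otimes^{\mathbf L}_A n}=\sigma\otimes^{\mathbf L}_A\cdots\otimes^{\mathbf L}_A\sigma$ ($n$ factors)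 is pure. Let $\sigma^{0}=A$ and let $\sigma^{n}$ be the bimodule $\sigma^{\otimes_A n}$ (which represents $\sigma^{\otimes^{\mathbf L}_A n}$, by purity). Let $$T=T_A(\sigma)=A\oplus\sigma\oplus\sigma^{2}\oplus\sigma^{3}\oplus\cdots$$ be the tensor algebra of $\sigma$ over $A$, graded with $\sigma^n$ in degree $n$. Consider the condition $(\ast)$ for every finitely presented right $A$-module $M$ there is an integer $m\ge 0$ such that for all $n\ge 0$ the complex $(M\otimes_A\sigma^{m})\otimes^{\mathbf L}_A\sigma^{n}$ is pure. 1. If $(\ast)$ holds, then $T$ is graded right coherent. 2. If $T$ has finite right graded global dimension and $T$ is graded right coherent, then $(\ast)$ holds. -/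

import Mathlib

universe v u
open CategoryTheory CategoryTheory.Limits

namespace DerivedTensor

/-- A projective resolution of a chain complex `X` concentrated in nonnegative degrees: a
quasi-isomorphism onto `X` from a degreewise projective complex. -/
structure ComplexResolution {C : Type u} [Category.{v} C] [Abelian C] (X : ChainComplex C ℕ) where
  complex : ChainComplex C ℕ
  projective : ∀ n, Projective (complex.X n)
  π : complex ⟶ X
  quasiIso : QuasiIso π

section Existence

variable {C : Type u} [Category.{v} C] [Abelian C] [EnoughProjectives C] (X : ChainComplex C ℕ)

/-- The degree `n` part of an inductively constructed resolution of `X`. -/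
structure Stage (n : ℕ) where
  P : C
  Q : C
  d : P ⟶ Q
  f : P ⟶ X.X n
  proj : Projective P

variable {X}

/-- The fibre product of the cycles constructed so far with the next term of `X`. -/
noncomputable abbrev Stage.pb {n : ℕ} (S : Stage X n) : C :=
  pullback (kernel.ι S.d ≫ S.f) (X.d (n + 1) n)

/-- The inductive step: cover the fibre product by a projective object. -/
noncomputable def Stage.next {n : ℕ} (S : Stage X n) : Stage X (n + 1) where
  P := Projective.over S.pb
  Q := S.P
  d := Projective.π S.pb ≫ pullback.fst _ _ ≫ kernel.ι S.d
  f := Projective.π S.pb ≫ pullback.snd _ _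
  proj := inferInstance

variable (X)

/-- All the stages of the construction. -/
noncomputable def stage : ∀ n : ℕ, Stage X n
  | 0 => ⟨Projective.over (X.X 0), Projective.over (X.X 0), 0, Projective.π _, inferInstance⟩
  | n + 1 => (stage n).next

/-- The differential of the constructed resolution. -/
noncomputable def stageD (n : ℕ) : (stage X (n + 1)).P ⟶ (stage X n).P := (stage X n).next.d

theorem stageD_comp_d (n : ℕ) : stageD X n ≫ (stage X n).d = 0 := by
  have h : ∀ {A B : C} (p : A ⟶ B) (q : B ⟶ kernel (stage X n).d),
      (p ≫ q ≫ kernel.ι (stage X n).d) ≫ (stage X n).d = 0 := by simp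
  exact h _ _

theorem stageD_comp_f (n : ℕ) : stageD X n ≫ (stage X n).f =
    (stage X (n + 1)).f ≫ X.d (n + 1) n := by
  simp only [stageD, Stage.next, stage, Category.assoc]
  rw [pullback.condition]

/-- The constructed complex. -/
noncomputable def stageComplex : ChainComplex C ℕ :=
  ChainComplex.of (fun n => (stage X n).P) (stageD X) (fun n => stageD_comp_d X (n + 1))

theorem stageComplex_d (n : ℕ) : (stageComplex X).d (n + 1) n = stageD X n :=
  ChainComplex.of_d (fun n => (stage X n).P) (stageD X) n

/-- The constructed map onto `X`. -/
noncomputable def stageMap : stageComplex X ⟶ X where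
  f n := (stage X n).f
  comm' i j hij := by
    obtain rfl : j + 1 = i := hij
    rw [stageComplex_d]
    exact (stageD_comp_f X j).symm

theorem stage_d_eq_zero {A : C} (n : ℕ) (x : A ⟶ (stage X n).P)
    (hx : x ≫ (stageComplex X).d n ((ComplexShape.down ℕ).next n) = 0) :
    x ≫ (stage X n).d = 0 := by
  cases n with
  | zero => exact comp_zero
  | succ n =>
    have h : (ComplexShape.down ℕ).next (n + 1) = n := by simp
    rw [h, stageComplex_d] at hx
    exact hx

theorem stage_lift {A : C} (n : ℕ) (x : A ⟶ (stage X n).P) (hx : x ≫ (stage X n).d = 0)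
    (y : A ⟶ X.X (n + 1)) (h : x ≫ (stage X n).f = y ≫ X.d (n + 1) n) :
    ∃ (A' : C) (π : A' ⟶ A) (_ : Epi π) (z : A' ⟶ (stage X (n + 1)).P),
      π ≫ x = z ≫ stageD X n ∧ π ≫ y = z ≫ (stage X (n + 1)).f := by
  obtain ⟨A', π, hπ, z, hz⟩ := surjective_up_to_refinements_of_epi (Projective.π (stage X n).pb)
    (pullback.lift (kernel.lift _ x hx) y (by simpa using h))
  refine ⟨A', π, hπ, z, ?_, ?_⟩
  · have h1 := congrArg (fun t => t ≫ pullback.fst _ _ ≫ kernel.ι _) hz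
    simp only [Category.assoc, pullback.lift_fst_assoc, kernel.lift_ι] at h1
    exact h1
  · have h1 := congrArg (fun t => t ≫ pullback.snd _ _) hz
    simp only [Category.assoc, pullback.lift_snd] at h1
    exact h1

theorem quasiIso_stageMap : QuasiIso (stageMap X) where
  quasiIsoAt n := by
    rw [quasiIsoAt_iff_isIso_homologyMap]
    have hm : Mono (HomologicalComplex.homologyMap (stageMap X) n) := by
      rw [HomologicalComplex.mono_homologyMap_iff_up_to_refinements (stageMap X) (n + 1) n _
        (by simp) rfl]
      intro A x hx y h
      obtain ⟨A', π, hπ, z, hz, -⟩ := stage_lift X n x (stage_d_eq_zero X n x hx) y h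
      exact ⟨A', π, hπ, z, by rw [stageComplex_d]; exact hz⟩
    have he : Epi (HomologicalComplex.homologyMap (stageMap X) n) := by
      rw [HomologicalComplex.epi_homologyMap_iff_up_to_refinements (stageMap X) (n + 1) n _
        (by simp) rfl]
      intro A y hy
      cases n with
      | zero =>
        obtain ⟨A', π, hπ, z, hz⟩ := surjective_up_to_refinements_of_epi (Projective.π (X.X 0)) y
        refine ⟨A', π, hπ, z, ?_, 0, ?_⟩
        · have h0 : (stageComplex X).d 0 ((ComplexShape.down ℕ).next 0) = 0 :=
            HomologicalComplex.shape _ _ _ (by simp)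
          exact (congrArg (fun t => z ≫ t) h0).trans comp_zero
        · rw [zero_comp, add_zero]; exact hz
      | succ n =>
        have hn : (ComplexShape.down ℕ).next (n + 1) = n := by simp
        rw [hn] at hy ⊢
        obtain ⟨A', π, hπ, z, hz, hz'⟩ := stage_lift X n (0 : A ⟶ _) zero_comp y
          (by rw [zero_comp, hy])
        refine ⟨A', π, hπ, z, ?_, 0, ?_⟩
        · rw [stageComplex_d]; exact hz.symm.trans comp_zero
        · rw [zero_comp, add_zero]; exact hz'
    exact isIso_of_mono_of_epi _

theorem nonempty_complexResolution : Nonempty (ComplexResolution X) :=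
  ⟨⟨stageComplex X, fun n => (stage X n).proj, stageMap X, quasiIso_stageMap X⟩⟩

end Existence
end DerivedTensor

/-- A complex in nonnegative homological degrees is pure if its homology is concentrated in
degree `0`. -/
def DerivedTensor.IsPure {C : Type u} [Category.{v} C] [Abelian C] (X : ChainComplex C ℕ) : Prop :=
  ∀ i, i ≠ 0 → X.ExactAt i

open scoped TensorProduct DirectSum
open MulOpposite (op)

/-- The tensor product `M ⊗_A N` of a right `A`-module `M` and a left `A`-module `N` over a
possibly noncommutative ring `A`, as a quotient of the tensor product over `ℤ`. Right modules are
modules over `Aᵐᵒᵖ`. -/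
def BalTensor (A : Type u) [Ring A] (M N : Type u) [AddCommGroup M] [Module Aᵐᵒᵖ M]
    [AddCommGroup N] [Module A N] : Type u :=
  (M ⊗[ℤ] N) ⧸ AddSubgroup.closure
    {t : M ⊗[ℤ] N | ∃ (m : M) (a : A) (n : N), t = (op a • m) ⊗ₜ[ℤ] n - m ⊗ₜ[ℤ] (a • n)}

namespace BalTensor

section Basic

variable (A : Type u) [Ring A] {M N P : Type u} [AddCommGroup M] [Module Aᵐᵒᵖ M]
  [AddCommGroup N] [Module A N] [AddCommGroup P]

instance : AddCommGroup (BalTensor A M N) := by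
  unfold BalTensor; infer_instance

/-- The pure tensor `m ⊗ n` in `M ⊗_A N`, as a biadditive map. -/
def mk : M →+ N →+ BalTensor A M N :=
  AddMonoidHom.mk' (fun m => AddMonoidHom.mk'
      (fun n => (QuotientAddGroup.mk (m ⊗ₜ[ℤ] n) : (M ⊗[ℤ] N) ⧸ AddSubgroup.closure _))
      (fun n n' => by rw [TensorProduct.tmul_add]; rfl))
    (fun m m' => by ext n; simp only [TensorProduct.add_tmul]; rfl)

theorem mk_smul (m : M) (a : A) (n : N) : mk A (op a • m) n = mk A m (a • n) := by
  refine (QuotientAddGroup.eq_iff_sub_mem).2 ?_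
  exact AddSubgroup.subset_closure ⟨m, a, n, rfl⟩

/-- The universal property: a balanced biadditive map induces a map on `M ⊗_A N`. -/
def lift (f : M →+ N →+ P) (hf : ∀ m (a : A) n, f (op a • m) n = f m (a • n)) :
    BalTensor A M N →+ P :=
  QuotientAddGroup.lift _ (TensorProduct.liftAddHom f (fun z m n => by simp)) (by
    rw [AddSubgroup.closure_le]
    rintro _ ⟨m, a, n, rfl⟩
    simp [hf])

@[simp] theorem lift_mk (f : M →+ N →+ P) (hf) (m : M) (n : N) :
    lift A f hf (mk A m n) = f m n := rfl

variable {A}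

@[ext high] theorem addHom_ext {f g : BalTensor A M N →+ P}
    (h : ∀ m n, f (mk A m n) = g (mk A m n)) : f = g := by
  refine QuotientAddGroup.addMonoidHom_ext _ ?_
  ext t
  induction t using TensorProduct.induction_on with
  | zero => rw [map_zero, map_zero]
  | tmul m n => exact h m n
  | add x y hx hy => rw [map_add, map_add, hx, hy]

end Basic

section Bimodule

variable (A : Type u) [Ring A] {M M' M'' N : Type u}
  [AddCommGroup M] [Module Aᵐᵒᵖ M] [AddCommGroup M'] [Module Aᵐᵒᵖ M']
  [AddCommGroup M''] [Module Aᵐᵒᵖ M'']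
  [AddCommGroup N] [Module A N]

/-- Functoriality of `M ⊗_A N` in both variables, on underlying groups. -/
def map {N' : Type u} [AddCommGroup N'] [Module A N'] (f : M →ₗ[Aᵐᵒᵖ] M') (g : N →ₗ[A] N') :
    BalTensor A M N →+ BalTensor A M' N' :=
  lift A (((mk A).comp f.toAddMonoidHom).compr₂ (AddMonoidHom.id _) |>.flip.comp
      g.toAddMonoidHom |>.flip) (fun m a n => by simp [mk_smul])

@[simp] theorem map_mk {N' : Type u} [AddCommGroup N'] [Module A N'] (f : M →ₗ[Aᵐᵒᵖ] M')
    (g : N →ₗ[A] N') (m : M) (n : N) : map A f g (mk A m n) = mk A (f m) (g n) := rfl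

section Right

variable [Module Aᵐᵒᵖ N] [SMulCommClass A Aᵐᵒᵖ N]

/-- Right multiplication on a bimodule, as a left linear map. -/
def mulRight (N : Type u) [AddCommGroup N] [Module A N] [Module Aᵐᵒᵖ N] [SMulCommClass A Aᵐᵒᵖ N]
    (b : Aᵐᵒᵖ) : N →ₗ[A] N where
  toFun n := b • n
  map_add' := smul_add b
  map_smul' a n := (smul_comm a b n).symm

/-- The right module structure `(m ⊗ n) b = m ⊗ (n b)` when `N` is a bimodule. -/
instance rightModule : Module Aᵐᵒᵖ (BalTensor A M N) where
  smul b := map A LinearMap.id (mulRight A N b)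
  one_smul t := by
    refine DFunLike.congr_fun (?_ : map A LinearMap.id (mulRight A N 1) = AddMonoidHom.id _) t
    ext m n; simp [mulRight]
  mul_smul b c t := by
    refine DFunLike.congr_fun (?_ : map A LinearMap.id (mulRight A N (b * c)) =
      (map A LinearMap.id (mulRight A N b)).comp (map A LinearMap.id (mulRight A N c))) t
    ext m n; simp [mulRight, mul_smul]
  smul_zero b := map_zero (map A LinearMap.id (mulRight A N b))
  smul_add b := map_add (map A LinearMap.id (mulRight A N b))
  add_smul b c t := by
    refine DFunLike.congr_fun (?_ : map A LinearMap.id (mulRight A N (b + c)) =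
      map A LinearMap.id (mulRight A N b) + map A LinearMap.id (mulRight A N c)) t
    ext m n; simp [mulRight, add_smul]
  zero_smul t := by
    refine DFunLike.congr_fun (?_ : map A LinearMap.id (mulRight A N 0) = 0) t
    ext m n; simp [mulRight]

@[simp] theorem smul_mk (b : Aᵐᵒᵖ) (m : M) (n : N) : b • mk A m n = mk A m (b • n) := rfl

@[ext high] theorem linearMap_ext {P : Type u} [AddCommGroup P] [Module Aᵐᵒᵖ P]
    {f g : BalTensor A M N →ₗ[Aᵐᵒᵖ] P} (h : ∀ m n, f (mk A m n) = g (mk A m n)) : f = g := by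
  refine LinearMap.toAddMonoidHom_injective ?_
  ext m n
  exact h m n

variable (N) in
/-- The map `f ⊗ id : M ⊗_A N → M' ⊗_A N` of right modules. -/
def rMap (f : M →ₗ[Aᵐᵒᵖ] M') : BalTensor A M N →ₗ[Aᵐᵒᵖ] BalTensor A M' N where
  toFun := map A f LinearMap.id
  map_add' := map_add _
  map_smul' b t := by
    refine DFunLike.congr_fun (?_ : (map A f LinearMap.id).comp
      (map A LinearMap.id (mulRight A N b)) =
      (map A LinearMap.id (mulRight A N b)).comp (map A f LinearMap.id)) t
    ext m n; simp

@[simp] theorem rMap_mk (f : M →ₗ[Aᵐᵒᵖ] M') (m : M) (n : N) :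
    rMap A N f (mk A m n) = mk A (f m) n := rfl

variable (M M' N) in
/-- `f ↦ f ⊗ id` is additive in `f`. -/
def rMapHom : (M →ₗ[Aᵐᵒᵖ] M') →+ (BalTensor A M N →ₗ[Aᵐᵒᵖ] BalTensor A M' N) :=
  AddMonoidHom.mk' (rMap A N) (fun f g => by ext m n; simp)

@[simp] theorem rMapHom_apply (f : M →ₗ[Aᵐᵒᵖ] M') : rMapHom A M M' N f = rMap A N f := rfl

end Right

section Left

variable [Module A M] [SMulCommClass A Aᵐᵒᵖ M]

/-- Left multiplication on a bimodule, as a right linear map. -/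
def mulLeft (M : Type u) [AddCommGroup M] [Module A M] [Module Aᵐᵒᵖ M] [SMulCommClass A Aᵐᵒᵖ M]
    (a : A) : M →ₗ[Aᵐᵒᵖ] M where
  toFun m := a • m
  map_add' := smul_add a
  map_smul' b m := smul_comm a b m

/-- The left module structure `a (m ⊗ n) = (a m) ⊗ n` when `M` is a bimodule. -/
instance leftModule : Module A (BalTensor A M N) where
  smul a := map A (mulLeft A M a) LinearMap.id
  one_smul t := by
    refine DFunLike.congr_fun (?_ : map A (mulLeft A M 1) LinearMap.id = AddMonoidHom.id _) t
    ext m n; simp [mulLeft]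
  mul_smul b c t := by
    refine DFunLike.congr_fun (?_ : map A (mulLeft A M (b * c)) LinearMap.id =
      (map A (mulLeft A M b) LinearMap.id).comp (map A (mulLeft A M c) LinearMap.id)) t
    ext m n; simp [mulLeft, mul_smul]
  smul_zero b := map_zero (map A (mulLeft A M b) LinearMap.id)
  smul_add b := map_add (map A (mulLeft A M b) LinearMap.id)
  add_smul b c t := by
    refine DFunLike.congr_fun (?_ : map A (mulLeft A M (b + c)) LinearMap.id =
      map A (mulLeft A M b) LinearMap.id + map A (mulLeft A M c) LinearMap.id) t
    ext m n; simp [mulLeft, add_smul]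
  zero_smul t := by
    refine DFunLike.congr_fun (?_ : map A (mulLeft A M 0) LinearMap.id = 0) t
    ext m n; simp [mulLeft]

@[simp] theorem left_smul_mk (a : A) (m : M) (n : N) : a • mk A m n = mk A (a • m) n := rfl

instance [Module Aᵐᵒᵖ N] [SMulCommClass A Aᵐᵒᵖ N] : SMulCommClass A Aᵐᵒᵖ (BalTensor A M N) where
  smul_comm a b t := by
    refine DFunLike.congr_fun (?_ : (map A (mulLeft A M a) LinearMap.id).comp
      (map A LinearMap.id (mulRight A N b)) =
      (map A LinearMap.id (mulRight A N b)).comp (map A (mulLeft A M a) LinearMap.id)) t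
    ext m n; simp

end Left

end Bimodule

end BalTensor

/-- An `A`-`A`-bimodule: commuting left and right `A`-module structures on an abelian group. -/
structure RingBimod (A : Type u) [Ring A] where
  carrier : Type u
  [addCommGroup : AddCommGroup carrier]
  [leftModule : Module A carrier]
  [rightModule : Module Aᵐᵒᵖ carrier]
  [smulCommClass : SMulCommClass A Aᵐᵒᵖ carrier]

namespace RingBimod

attribute [instance] addCommGroup leftModule rightModule smulCommClass

variable {A : Type u} [Ring A]

instance : CoeSort (RingBimod A) (Type u) := ⟨carrier⟩

/-- The right `A`-module underlying a bimodule. -/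
abbrev toRight (B : RingBimod A) : ModuleCat.{u} Aᵐᵒᵖ := ModuleCat.of Aᵐᵒᵖ B

variable (A) in
/-- The regular bimodule `A`. -/
abbrev regular : RingBimod A := ⟨A⟩

/-- The tensor product of bimodules. -/
abbrev tensor (B B' : RingBimod A) : RingBimod A := ⟨BalTensor A B B'⟩

/-- The tensor powers `σ^{⊗ n}`: `A` for `n = 0` and `σ^{⊗ n} ⊗_A σ` for `n + 1`. -/
def pow (σ : RingBimod A) : ℕ → RingBimod A
  | 0 => regular A
  | n + 1 => tensor (pow σ n) σ

/-- The functor `- ⊗_A B` on right `A`-modules. -/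
def tensorRight (B : RingBimod A) : ModuleCat.{u} Aᵐᵒᵖ ⥤ ModuleCat.{u} Aᵐᵒᵖ where
  obj M := ModuleCat.of Aᵐᵒᵖ (BalTensor A M B)
  map f := ModuleCat.ofHom (BalTensor.rMap A B f.hom)
  map_id M := by
    apply ModuleCat.hom_ext
    ext m n
    simp
  map_comp f g := by
    apply ModuleCat.hom_ext
    ext m n
    simp

instance (B : RingBimod A) : (tensorRight B).Additive where
  map_add {M N f g} := by
    apply ModuleCat.hom_ext
    exact (BalTensor.rMapHom A M N B).map_add f.hom g.hom

/-- The derived tensor product `X ⊗^L_A B` of a complex `X` of right `A`-modules with a bimodule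
`B`, computed by a projective resolution of `X` (well defined up to quasi-isomorphism). -/
noncomputable def derivedTensor (X : ChainComplex (ModuleCat.{u} Aᵐᵒᵖ) ℕ) (B : RingBimod A) :
    ChainComplex (ModuleCat.{u} Aᵐᵒᵖ) ℕ :=
  (B.tensorRight.mapHomologicalComplex _).obj
    (Classical.choice (DerivedTensor.nonempty_complexResolution X)).complex

/-- The derived tensor product `M ⊗^L_A B` of a right `A`-module `M` with a bimodule `B`. -/
noncomputable def derivedTensorModule (M : ModuleCat.{u} Aᵐᵒᵖ) (B : RingBimod A) :
    ChainComplex (ModuleCat.{u} Aᵐᵒᵖ) ℕ :=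
  derivedTensor ((ChainComplex.single₀ _).obj M) B

/-- The iterated derived tensor powers `σ ⊗^L_A ⋯ ⊗^L_A σ`, as complexes of right modules. -/
noncomputable def derivedPow (σ : RingBimod A) : ℕ → ChainComplex (ModuleCat.{u} Aᵐᵒᵖ) ℕ
  | 0 => (ChainComplex.single₀ _).obj (toRight (regular A))
  | 1 => (ChainComplex.single₀ _).obj (toRight σ)
  | n + 2 => derivedTensor (derivedPow σ (n + 1)) σ

/-! The multiplication of the tensor algebra. -/

variable (σ : RingBimod A)

/-- The multiplication `σ^{⊗ m} × σ^{⊗ n} → σ^{⊗ (m + n)}`, given by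
`x · a = x a` for `a` in `σ^{⊗ 0} = A` and `x · (y ⊗ s) = (x · y) ⊗ s`. -/
def mulHom (m : ℕ) : ∀ n : ℕ, pow σ m →+ (pow σ n →ₗ[Aᵐᵒᵖ] pow σ (m + n))
  | 0 => AddMonoidHom.mk' (fun x => show A →ₗ[Aᵐᵒᵖ] pow σ m from
      { toFun := fun a => op a • x
        map_add' := fun a b => by rw [MulOpposite.op_add, add_smul]
        map_smul' := fun b a => by
          rw [RingHom.id_apply, smul_smul]; rfl })
      (fun x y => LinearMap.ext fun a => smul_add (op a) x y)
  | n + 1 => (BalTensor.rMapHom A (pow σ n) (pow σ (m + n)) σ).comp (mulHom m n)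

/-- Pure tensors `y ⊗ s` in `σ^{⊗ (n + 1)}`. -/
def tmul (n : ℕ) (y : pow σ n) (s : σ) : pow σ (n + 1) := BalTensor.mk A y s

theorem mulHom_zero (m : ℕ) (x : pow σ m) (a : A) : mulHom σ m 0 x a = op a • x := rfl

theorem mulHom_tmul (m n : ℕ) (x : pow σ m) (y : pow σ n) (s : σ) :
    mulHom σ m (n + 1) x (tmul σ n y s) = tmul σ (m + n) (mulHom σ m n x y) s := rfl

theorem pow_hom_ext {n : ℕ} {P : Type u} [AddCommGroup P] [Module Aᵐᵒᵖ P]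
    {f g : pow σ (n + 1) →ₗ[Aᵐᵒᵖ] P} (h : ∀ y s, f (tmul σ n y s) = g (tmul σ n y s)) : f = g :=
  BalTensor.linearMap_ext A h

/-- Transport along an equality of exponents. -/
def powCast {m n : ℕ} (h : m = n) : pow σ m →ₗ[Aᵐᵒᵖ] pow σ n := h ▸ LinearMap.id

theorem powCast_tmul {m n : ℕ} (h : m = n) (y : pow σ m) (s : σ) :
    powCast σ (congrArg (· + 1) h) (tmul σ m y s) = tmul σ n (powCast σ h y) s := by
  subst h; rfl

theorem mk_eq_of_powCast {m n : ℕ} (h : m = n) (x : pow σ m) (y : pow σ n)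
    (hxy : powCast σ h x = y) :
    (⟨m, x⟩ : GradedMonoid (fun n => (pow σ n : Type u))) = ⟨n, y⟩ := by
  subst h; subst hxy; rfl

/-- The unit of the tensor algebra. -/
def powOne : pow σ 0 := (1 : A)

theorem powCast_one_mul : ∀ n : ℕ,
    (powCast σ (Nat.zero_add n)).comp (mulHom σ 0 n (powOne σ)) = LinearMap.id
  | 0 => by
    refine LinearMap.ext fun (a : A) => ?_
    exact one_mul a
  | n + 1 => by
    refine pow_hom_ext σ fun y s => ?_
    have h := DFunLike.congr_fun (powCast_one_mul n) y
    rw [LinearMap.comp_apply] at h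
    rw [LinearMap.comp_apply, mulHom_tmul, powCast_tmul σ (Nat.zero_add n), h]
    rfl

theorem powCast_mul_assoc (m n : ℕ) (x : pow σ m) (y : pow σ n) : ∀ k : ℕ,
    (powCast σ (Nat.add_assoc m n k)).comp (mulHom σ (m + n) k (mulHom σ m n x y)) =
      (mulHom σ m (n + k) x).comp (mulHom σ n k y)
  | 0 => by
    refine LinearMap.ext fun (a : A) => ?_
    exact ((mulHom σ m n x).map_smul (op a) y).symm
  | k + 1 => by
    refine pow_hom_ext σ fun z s => ?_
    have h := DFunLike.congr_fun (powCast_mul_assoc m n x y k) z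
    rw [LinearMap.comp_apply, LinearMap.comp_apply] at h
    rw [LinearMap.comp_apply, mulHom_tmul, powCast_tmul σ (Nat.add_assoc m n k), h]
    rfl

instance gMul : GradedMonoid.GMul (fun n => (pow σ n : Type u)) where
  mul x y := mulHom σ _ _ x y

instance gOne : GradedMonoid.GOne (fun n => (pow σ n : Type u)) where
  one := powOne σ

instance gRing : DirectSum.GRing (fun n => (pow σ n : Type u)) where
  toGMul := gMul σ
  toGOne := gOne σ
  mul_zero x := map_zero (mulHom σ _ _ x)
  zero_mul y := DFunLike.congr_fun (map_zero (mulHom σ _ _)) y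
  mul_add x := map_add (mulHom σ _ _ x)
  add_mul x y z := DFunLike.congr_fun (map_add (mulHom σ _ _) x y) z
  one_mul x := mk_eq_of_powCast σ (Nat.zero_add _) _ _
    (DFunLike.congr_fun (powCast_one_mul σ x.1) x.2)
  mul_one x := mk_eq_of_powCast σ (Nat.add_zero _) _ _ (one_smul Aᵐᵒᵖ x.2)
  mul_assoc x y z := mk_eq_of_powCast σ (Nat.add_assoc _ _ _) _ _
    (DFunLike.congr_fun (powCast_mul_assoc σ x.1 y.1 x.2 y.2 z.1) z.2)
  natCast n := (n : A)
  natCast_zero := Nat.cast_zero (R := A)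
  natCast_succ n := Nat.cast_succ (R := A) n
  intCast n := (n : A)
  intCast_ofNat n := Int.cast_natCast (R := A) n
  intCast_negSucc_ofNat n := Int.cast_negSucc (R := A) n

/-- The tensor algebra `T_A(σ) = A ⊕ σ ⊕ σ^{⊗ 2} ⊕ ⋯`. -/
abbrev TensorAlg : Type u := ⨁ n : ℕ, (pow σ n : Type u)

/-- The grading of the tensor algebra with `σ` in degree `1`; negative degrees vanish. -/
def grading : ℤ → AddSubgroup (TensorAlg σ)
  | Int.ofNat n => (DirectSum.of (fun n => (pow σ n : Type u)) n).range
  | Int.negSucc _ => ⊥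

theorem of_mem_grading (n : ℕ) (x : pow σ n) :
    DirectSum.of (fun n => (pow σ n : Type u)) n x ∈ grading σ (n : ℤ) := ⟨x, rfl⟩

instance : SetLike.GradedMonoid (grading σ) where
  one_mem := of_mem_grading σ 0 (powOne σ)
  mul_mem i j x y hx hy := by
    match i, j, hx, hy with
    | Int.negSucc _, _, hx, _ =>
      rw [(AddSubgroup.mem_bot.1 hx : x = 0), zero_mul]; exact zero_mem _
    | Int.ofNat _, Int.negSucc _, _, hy =>
      rw [(AddSubgroup.mem_bot.1 hy : y = 0), mul_zero]; exact zero_mem _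
    | Int.ofNat m, Int.ofNat n, ⟨x, hx⟩, ⟨y, hy⟩ =>
      rw [← hx, ← hy, DirectSum.of_mul_of]
      exact of_mem_grading σ (m + n) _

/-- The decomposition of an element of the tensor algebra into homogeneous components. -/
def decomposeHom : TensorAlg σ →+ ⨁ i : ℤ, grading σ i :=
  DirectSum.toAddMonoid fun n =>
    (DirectSum.of (fun i : ℤ => grading σ i) (n : ℤ)).comp
      ((DirectSum.of (fun n => (pow σ n : Type u)) n).codRestrict (grading σ n)
        (of_mem_grading σ n))

instance : GradedRing (grading σ) where
  toDecomposition := DirectSum.Decomposition.ofAddHom (grading σ) (decomposeHom σ)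
    (by
      ext n x : 2
      simp [decomposeHom])
    (by
      ext i x : 2
      match i, x with
      | Int.negSucc k, ⟨x, hx⟩ =>
        obtain rfl : x = 0 := AddSubgroup.mem_bot.1 hx
        have : (⟨0, hx⟩ : grading σ (Int.negSucc k)) = 0 := rfl
        rw [this, map_zero, map_zero]
      | Int.ofNat n, ⟨_, x, rfl⟩ =>
        simp [decomposeHom])

end RingBimod

/-- A right `A`-module `M` is coherent if it is finitely generated and the kernel of every
homomorphism from a finitely generated free module to `M` is finitely generated. -/
def IsCoherentRightModule (A : Type u) [Ring A] (M : Type u) [AddCommGroup M] [Module Aᵐᵒᵖ M] :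
    Prop :=
  Module.Finite Aᵐᵒᵖ M ∧ ∀ (k : ℕ) (f : (Fin k → A) →ₗ[Aᵐᵒᵖ] M), (LinearMap.ker f).FG

/-- `A` is right coherent if the right module `A` is coherent. -/
def IsRightCoherent (A : Type u) [Ring A] : Prop := IsCoherentRightModule A A

/-- A `ℤ`-graded right module over a `ℤ`-graded ring `S = ⨁ 𝒮 i`. -/
structure GradedRightModule (S : Type u) [Ring S] (𝒮 : ℤ → AddSubgroup S) where
  carrier : Type u
  [addCommGroup : AddCommGroup carrier]
  [module : Module Sᵐᵒᵖ carrier]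
  deg : ℤ → AddSubgroup carrier
  isInternal : DirectSum.IsInternal deg
  smul_mem : ∀ (i j : ℤ) (x : carrier) (s : S), x ∈ deg i → s ∈ 𝒮 j → op s • x ∈ deg (i + j)

namespace GradedRightModule

attribute [instance] addCommGroup module

variable {S : Type u} [Ring S] {𝒮 : ℤ → AddSubgroup S}

instance : CoeSort (GradedRightModule S 𝒮) (Type u) := ⟨carrier⟩

variable (𝒮) in
/-- The ring `S` as a graded right module over itself. -/
def regular [GradedRing 𝒮] : GradedRightModule S 𝒮 where
  carrier := S
  deg := 𝒮
  isInternal := DirectSum.Decomposition.isInternal 𝒮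
  smul_mem _ _ _ _ hx hs := SetLike.mul_mem_graded hx hs

/-- A graded homomorphism is a module homomorphism which preserves degrees. -/
def IsGradedHom {M N : GradedRightModule S 𝒮} (f : M →ₗ[Sᵐᵒᵖ] N) : Prop :=
  ∀ (i : ℤ) (x : M), x ∈ M.deg i → f x ∈ N.deg i

variable (𝒮) in
/-- The grading of the finitely generated graded free right module `S(-d 1) ⊕ ⋯ ⊕ S(-d k)`:
the degree `i` part consists of the vectors with `j`-th entry in `𝒮 (i - d j)`. -/
def freeDeg {k : ℕ} (d : Fin k → ℤ) (i : ℤ) : AddSubgroup (Fin k → S) :=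
  AddSubgroup.pi Set.univ fun j => 𝒮 (i - d j)

/-- A graded right module `M` is graded coherent if it is finitely generated and the kernel of
every graded homomorphism from a finitely generated graded free module to `M` is finitely
generated. -/
def IsGradedCoherent (M : GradedRightModule S 𝒮) : Prop :=
  Module.Finite Sᵐᵒᵖ M ∧ ∀ (k : ℕ) (d : Fin k → ℤ) (f : (Fin k → S) →ₗ[Sᵐᵒᵖ] M),
    (∀ (i : ℤ) (v : Fin k → S), v ∈ freeDeg 𝒮 d i → f v ∈ M.deg i) → (LinearMap.ker f).FG

/-- A graded right module is graded projective if it has the lifting property with respect to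
surjective graded homomorphisms, i.e. if it is a projective object of the category of graded
right modules. -/
def IsGradedProjective (P : GradedRightModule S 𝒮) : Prop :=
  ∀ (M N : GradedRightModule S 𝒮) (g : M →ₗ[Sᵐᵒᵖ] N) (f : P →ₗ[Sᵐᵒᵖ] N),
    IsGradedHom g → Function.Surjective g → IsGradedHom f →
      ∃ h : P →ₗ[Sᵐᵒᵖ] M, IsGradedHom h ∧ g.comp h = f

/-- `M` has graded projective dimension at most `n`: there is an exact sequence
`0 → P_n → ⋯ → P_0 → M → 0` of graded modules with all `P_i` graded projective (spelled out
recursively through the first syzygy). -/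
def ProjDimLE : ℕ → GradedRightModule S 𝒮 → Prop
  | 0, M => IsGradedProjective M
  | n + 1, M => ∃ (K P : GradedRightModule S 𝒮) (i : K →ₗ[Sᵐᵒᵖ] P) (p : P →ₗ[Sᵐᵒᵖ] M),
      IsGradedProjective P ∧ IsGradedHom i ∧ IsGradedHom p ∧ Function.Injective i ∧
        Function.Exact i p ∧ Function.Surjective p ∧ ProjDimLE n K

end GradedRightModule

/-- The graded ring `S` is graded right coherent if the graded right module `S` is graded
coherent. -/
def IsGradedRightCoherent {S : Type u} [Ring S] (𝒮 : ℤ → AddSubgroup S) [GradedRing 𝒮] : Prop :=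
  (GradedRightModule.regular 𝒮).IsGradedCoherent

/-- The graded ring `S` has finite right graded global dimension: the graded projective
dimensions of all graded right modules are bounded by one number. -/
def HasFiniteRightGradedGlobalDim {S : Type u} [Ring S] (𝒮 : ℤ → AddSubgroup S) : Prop :=
  ∃ n : ℕ, ∀ M : GradedRightModule S 𝒮, GradedRightModule.ProjDimLE n M

/-! Everything is reduced to the single functor `- ⊗ σ` on right `A`-modules, applied degree by
degree to graded matrices over `T`. Call `N` acyclic if `Tor_k(N, σ) = 0` for all `k ≥ 1`. Purity of
the derived powers says that every `σ^n` is acyclic (`torVanish_pow`). Given this, `N ⊗^L σ^n` is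
pure for all `n` exactly when `N ⊗ σ^n` is acyclic for all `n` (`torVanish_of_isPure`,
`isPure_of_torVanish`): if `P` is a projective resolution of `N`, then `P ⊗ σ^n` consists of acyclic
modules, and `P ⊗ σ^(n+1)` is `(P ⊗ σ^n) ⊗ σ`.

Let `f : F → G` be a graded map of finite free `T`-modules with cokernel `C`. Above the degrees of
the generators, multiplication gives `F_i ⊗ σ ≅ F_(i+1)` and likewise for `G`, so `C_(i+n) ≅ C_i ⊗
σ^n`. The kernel of `f` in degree `i + 1` is generated by its degree `i` part exactly when `im f_i ⊗
σ → G_i ⊗ σ` is injective, that is, when `Tor_1(C_i, σ) = 0`. Hence finite generation of `ker f` is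
governed by this vanishing for large `i` (`ker_fg_of_tensorInjective`, `exists_tensorInjective`);
the finitely many low degrees are controlled by coherence of `A`.

Part 1: some `C_i` is finitely presented over `A`, and condition (∗) for it makes all later `C_j`
acyclic, so `ker f` is finitely generated. Part 2: a presentation of `M` over `A`, read as a matrix
of degree 0 over `T`, has `C_n ≅ M ⊗ σ^n`. Coherence makes the injectivity above hold in large
degrees for `f` and for each of its successive syzygies, and dimension shifting turns this into
vanishing of the higher `Tor`. Finite global dimension stops the process after finitely many
syzygies, so one degree bound works for all `Tor_k` at once (`exists_torVanish_range`). -/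

namespace BalTensor

/-! ### Functoriality and right exactness of the tensor product. -/

section RightExactness

variable {A : Type u} [Ring A] {M M' M'' N : Type u}
  [AddCommGroup M] [Module Aᵐᵒᵖ M] [AddCommGroup M'] [Module Aᵐᵒᵖ M']
  [AddCommGroup M''] [Module Aᵐᵒᵖ M'']
  [AddCommGroup N] [Module A N]

@[elab_as_elim]
theorem induction_on {p : BalTensor A M N → Prop} (t : BalTensor A M N) (zero : p 0)
    (tmul : ∀ m n, p (mk A m n)) (add : ∀ x y, p x → p y → p (x + y)) : p t := by
  obtain ⟨t, rfl⟩ := QuotientAddGroup.mk_surjective t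
  induction t using TensorProduct.induction_on with
  | zero => exact zero
  | tmul m n => exact tmul m n
  | add x y hx hy => exact add _ _ hx hy

/-- The map out of `M ⊗ N` induced by a balanced biadditive function. -/
def liftFun {P : Type u} [AddCommGroup P] (f : M → N → P)
    (hl : ∀ m m' n, f (m + m') n = f m n + f m' n)
    (hr : ∀ m n n', f m (n + n') = f m n + f m n')
    (hb : ∀ m (a : A) n, f (op a • m) n = f m (a • n)) : BalTensor A M N →+ P :=
  lift A (AddMonoidHom.mk' (fun m => AddMonoidHom.mk' (f m) (hr m))
    (fun m m' => AddMonoidHom.ext fun n => hl m m' n)) hb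

variable [Module Aᵐᵒᵖ N] [SMulCommClass A Aᵐᵒᵖ N]

/-- The right linear map out of `M ⊗ N` induced by a balanced biadditive function which is right
linear in the second variable. -/
def liftLin {P : Type u} [AddCommGroup P] [Module Aᵐᵒᵖ P] (f : M → N → P)
    (hl : ∀ m m' n, f (m + m') n = f m n + f m' n)
    (hr : ∀ m n n', f m (n + n') = f m n + f m n')
    (hb : ∀ m (a : A) n, f (op a • m) n = f m (a • n))
    (hs : ∀ m (b : Aᵐᵒᵖ) n, f m (b • n) = b • f m n) : BalTensor A M N →ₗ[Aᵐᵒᵖ] P where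
  toFun := liftFun f hl hr hb
  map_add' := map_add _
  map_smul' b t := by
    induction t using induction_on with
    | zero => simp
    | tmul m n => exact hs m b n
    | add x y hx hy => rw [smul_add, map_add, hx, hy, map_add, smul_add]

theorem rMap_id : rMap A N (LinearMap.id : M →ₗ[Aᵐᵒᵖ] M) = LinearMap.id := by
  ext m n; rfl

theorem rMap_comp (g : M' →ₗ[Aᵐᵒᵖ] M'') (f : M →ₗ[Aᵐᵒᵖ] M') :
    rMap A N (g ∘ₗ f) = rMap A N g ∘ₗ rMap A N f := by
  ext m n; rfl

theorem rMap_comp_apply (g : M' →ₗ[Aᵐᵒᵖ] M'') (f : M →ₗ[Aᵐᵒᵖ] M') (t : BalTensor A M N) :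
    rMap A N g (rMap A N f t) = rMap A N (g ∘ₗ f) t := by
  rw [rMap_comp]; rfl

theorem rMap_zero : rMap A N (0 : M →ₗ[Aᵐᵒᵖ] M') = 0 := (rMapHom A M M' N).map_zero

theorem rMap_surjective {f : M →ₗ[Aᵐᵒᵖ] M'} (hf : Function.Surjective f) :
    Function.Surjective (rMap A N f) := by
  intro t
  induction t using induction_on with
  | zero => exact ⟨0, map_zero _⟩
  | tmul m n => obtain ⟨m, rfl⟩ := hf m; exact ⟨mk A m n, rfl⟩
  | add x y hx hy =>
    obtain ⟨x, rfl⟩ := hx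
    obtain ⟨y, rfl⟩ := hy
    exact ⟨x + y, map_add _ _ _⟩

theorem rMap_injective_of_leftInverse {f : M →ₗ[Aᵐᵒᵖ] M'} {g : M' →ₗ[Aᵐᵒᵖ] M}
    (h : g ∘ₗ f = LinearMap.id) : Function.Injective (rMap A N f) := by
  refine Function.LeftInverse.injective (g := rMap A N g) fun t => ?_
  rw [rMap_comp_apply, h, rMap_id]; rfl

/-- Right exactness of the tensor product. -/
theorem rMap_exact {f : M →ₗ[Aᵐᵒᵖ] M'} {g : M' →ₗ[Aᵐᵒᵖ] M''} (h : Function.Exact f g)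
    (hg : Function.Surjective g) : Function.Exact (rMap A N f) (rMap A N g) := by
  have key : ∀ (x y : M') (n : N), g x = g y →
      mk A x n - mk A y n ∈ (LinearMap.range (rMap A N f)).toAddSubgroup := by
    intro x y n hxy
    obtain ⟨z, hz⟩ := (h (x - y)).1 (by rw [map_sub, hxy, sub_self])
    exact ⟨mk A z n, by rw [rMap_mk, hz, map_sub, AddMonoidHom.sub_apply]⟩
  let Q := BalTensor A M' N ⧸ (LinearMap.range (rMap A N f)).toAddSubgroup
  let π : BalTensor A M' N →+ Q := QuotientAddGroup.mk' _
  have hπ : ∀ (x y : M') (n : N), g x = g y → π (mk A x n) = π (mk A y n) := by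
    intro x y n hxy
    rw [← sub_eq_zero, ← map_sub]
    exact (QuotientAddGroup.eq_zero_iff _).2 (key x y n hxy)
  let s := Function.surjInv hg
  have hs : ∀ x, g (s x) = x := Function.surjInv_eq hg
  -- The set-theoretic section `s` is neither additive nor linear, but by `hπ` it becomes so modulo
  -- the range of `f ⊗ id`. The resulting `φ` recovers the class of `t` from its image under `g ⊗
  -- id`.
  let φ : BalTensor A M'' N →+ Q := lift A
    (AddMonoidHom.mk' (fun x => π.comp (mk A (s x))) (fun x y => by
      ext n
      rw [AddMonoidHom.add_apply, AddMonoidHom.comp_apply, AddMonoidHom.comp_apply,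
        AddMonoidHom.comp_apply, ← map_add, ← AddMonoidHom.add_apply, ← map_add]
      exact hπ _ _ _ (by rw [map_add, hs, hs, hs])))
    (fun x a n => by
      change π (mk A (s (op a • x)) n) = π (mk A (s x) (a • n))
      rw [← mk_smul]
      exact hπ _ _ _ (by rw [map_smul, hs, hs]))
  have hφ : ∀ t, φ (rMap A N g t) = π t := by
    intro t
    induction t using induction_on with
    | zero => simp
    | tmul m n => exact hπ _ _ _ (hs _)
    | add x y hx hy => rw [map_add, map_add, map_add, hx, hy]
  intro t
  constructor
  · intro ht
    have := hφ t
    rw [ht, map_zero] at this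
    exact (QuotientAddGroup.eq_zero_iff _).1 this.symm
  · rintro ⟨t, rfl⟩
    rw [rMap_comp_apply, h.linearMap_comp_eq_zero, rMap_zero]; rfl

/-- Tensoring an isomorphism. -/
def rCongr (e : M ≃ₗ[Aᵐᵒᵖ] M') : BalTensor A M N ≃ₗ[Aᵐᵒᵖ] BalTensor A M' N :=
  LinearEquiv.ofLinearMap (rMap A N e.toLinearMap) (rMap A N e.symm.toLinearMap)
    (by rw [← rMap_comp, LinearEquiv.comp_coe, e.symm_trans_self, LinearEquiv.refl_toLinearMap,
      rMap_id])
    (by rw [← rMap_comp, LinearEquiv.comp_coe, e.self_trans_symm, LinearEquiv.refl_toLinearMap,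
      rMap_id])

/-- If the elements of `M` are finite sums of their components, the same holds in `M ⊗ N`; so an
element of `M ⊗ N` vanishes if its components do. -/
theorem eq_zero_of_components {ι : Type*} {X : ι → Type u} [∀ i, AddCommGroup (X i)]
    [∀ i, Module Aᵐᵒᵖ (X i)] (π : ∀ i, M →ₗ[Aᵐᵒᵖ] X i) (j : ∀ i, X i →ₗ[Aᵐᵒᵖ] M)
    (h : ∀ m : M, ∃ s : Finset ι, ∀ s', s ⊆ s' → ∑ i ∈ s', j i (π i m) = m)
    (t : BalTensor A M N) (ht : ∀ i, rMap A N (π i) t = 0) : t = 0 := by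
  classical
  have key : ∃ s : Finset ι, ∀ s', s ⊆ s' → ∑ i ∈ s', rMap A N (j i) (rMap A N (π i) t) = t := by
    clear ht
    induction t using induction_on with
    | zero => exact ⟨∅, fun s' _ => by simp⟩
    | tmul m n =>
      obtain ⟨s, hs⟩ := h m
      refine ⟨s, fun s' hs' => ?_⟩
      conv_rhs => rw [← hs s' hs', map_sum, AddMonoidHom.finsetSum_apply]
      rfl
    | add x y hx hy =>
      obtain ⟨s, hs⟩ := hx
      obtain ⟨s₂, hs₂⟩ := hy
      refine ⟨s ∪ s₂, fun s' hs' => ?_⟩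
      simp only [map_add, Finset.sum_add_distrib]
      rw [hs s' (Finset.union_subset_left hs'), hs₂ s' (Finset.union_subset_right hs')]
  obtain ⟨s, hs⟩ := key
  rw [← hs s subset_rfl]
  exact Finset.sum_eq_zero fun i _ => by rw [ht, map_zero]

end RightExactness

/-! ### Unit, associativity and direct sum isomorphisms. -/

section Isomorphisms

variable {A : Type u} [Ring A] {M M' N N' : Type u}
  [AddCommGroup M] [Module Aᵐᵒᵖ M] [AddCommGroup M'] [Module Aᵐᵒᵖ M']
  [AddCommGroup N] [Module A N] [Module Aᵐᵒᵖ N] [SMulCommClass A Aᵐᵒᵖ N]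
  [AddCommGroup N'] [Module A N'] [Module Aᵐᵒᵖ N'] [SMulCommClass A Aᵐᵒᵖ N']

variable (A M) in
/-- The isomorphism `M ⊗ A ≅ M`. -/
def rid : BalTensor A M A ≃ₗ[Aᵐᵒᵖ] M where
  toLinearMap := liftLin (fun m (a : A) => op a • m) (fun m m' a => smul_add _ m m')
    (fun m a a' => by rw [MulOpposite.op_add, add_smul])
    (fun m a n => by rw [smul_smul]; rfl)
    (fun m b n => by rw [smul_smul]; rfl)
  invFun m := mk A m (1 : A)
  left_inv t := by
    induction t using induction_on with
    | zero => simp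
    | tmul m n =>
      change mk A (op n • m) (1 : A) = mk A m n
      rw [mk_smul, smul_eq_mul, mul_one]
    | add x y hx hy =>
      refine Eq.trans ?_ (congrArg₂ (· + ·) hx hy)
      simp
  right_inv m := one_smul _ m

variable (A N) in
/-- The isomorphism `A ⊗ N ≅ N`. -/
def lid : BalTensor A A N ≃ₗ[Aᵐᵒᵖ] N where
  toLinearMap := liftLin (fun (a : A) (n : N) => a • n) (fun a a' n => add_smul a a' n)
    (fun a n n' => smul_add a n n') (fun m a n => mul_smul m a n)
    (fun m b n => smul_comm m b n)
  invFun n := mk A (1 : A) n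
  left_inv t := by
    induction t using induction_on with
    | zero => simp
    | tmul m n =>
      change mk A (1 : A) (m • n) = mk A m n
      rw [← mk_smul]
      exact congrArg (fun x => mk A x n) (one_mul m)
    | add x y hx hy =>
      refine Eq.trans ?_ (congrArg₂ (· + ·) hx hy)
      simp
  right_inv m := one_smul _ m

variable (M N) in
/-- The map `m ⊗ n ↦ m ⊗ (n ⊗ z)`. -/
def tmulRight (z : N') : BalTensor A M N →+ BalTensor A M (BalTensor A N N') :=
  liftFun (fun m n => mk A m (mk A n z)) (fun m m' n => by rw [map_add, AddMonoidHom.add_apply])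
    (fun m n n' => by rw [map_add, AddMonoidHom.add_apply, map_add])
    (fun m a n => mk_smul A m a (mk A n z))

theorem tmulRight_mk (z : N') (m : M) (n : N) :
    tmulRight M N z (mk A m n) = mk A m (mk A n z) := rfl

variable (N N') in
/-- The map `n ⊗ z ↦ (m ⊗ n) ⊗ z`. -/
def tmulLeft (m : M) : BalTensor A N N' →+ BalTensor A (BalTensor A M N) N' :=
  liftFun (fun n z => mk A (mk A m n) z)
    (fun n n' z => by rw [map_add, map_add, AddMonoidHom.add_apply])
    (fun n z z' => map_add _ z z') (fun n a z => mk_smul A (mk A m n) a z)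

theorem tmulLeft_mk (m : M) (n : N) (z : N') :
    tmulLeft N N' m (mk A n z) = mk A (mk A m n) z := rfl

variable (M N N') in
/-- One direction of associativity. -/
def assocHom : BalTensor A (BalTensor A M N) N' →ₗ[Aᵐᵒᵖ] BalTensor A M (BalTensor A N N') :=
  liftLin (fun t z => tmulRight M N z t)
    (fun t t' z => map_add _ t t')
    (fun t z z' => by
      induction t using induction_on with
      | zero => rw [map_zero, map_zero, map_zero, add_zero]
      | tmul m n => rw [tmulRight_mk, tmulRight_mk, tmulRight_mk, map_add, map_add]
      | add x y hx hy => rw [map_add, map_add, map_add, hx, hy]; abel)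
    (fun t a z => by
      induction t using induction_on with
      | zero => rw [smul_zero, map_zero, map_zero]
      | tmul m n =>
        rw [smul_mk, tmulRight_mk, tmulRight_mk]
        exact congrArg (mk A m) (mk_smul A n a z)
      | add x y hx hy => rw [smul_add, map_add, map_add, hx, hy])
    (fun t b z => by
      induction t using induction_on with
      | zero => rw [map_zero, map_zero, smul_zero]
      | tmul m n => rw [tmulRight_mk, tmulRight_mk]; rfl
      | add x y hx hy => rw [map_add, map_add, hx, hy, smul_add])

variable (M N N') in
/-- The other direction of associativity. -/
def assocInvHom : BalTensor A M (BalTensor A N N') →ₗ[Aᵐᵒᵖ] BalTensor A (BalTensor A M N) N' :=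
  liftLin (fun m t => tmulLeft N N' m t)
    (fun m m' t => by
      induction t using induction_on with
      | zero => rw [map_zero, map_zero, map_zero, add_zero]
      | tmul n z =>
        rw [tmulLeft_mk, tmulLeft_mk, tmulLeft_mk, map_add, AddMonoidHom.add_apply, map_add,
          AddMonoidHom.add_apply]
      | add x y hx hy => rw [map_add, map_add, map_add, hx, hy]; abel)
    (fun m t t' => map_add _ t t')
    (fun m a t => by
      induction t using induction_on with
      | zero => rw [smul_zero, map_zero, map_zero]
      | tmul n z =>
        rw [left_smul_mk, tmulLeft_mk, tmulLeft_mk]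
        exact congrArg (fun s => mk A s z) (mk_smul A m a n)
      | add x y hx hy => rw [smul_add, map_add, map_add, hx, hy])
    (fun m b t => by
      induction t using induction_on with
      | zero => rw [smul_zero, map_zero, smul_zero]
      | tmul n z => rw [smul_mk, tmulLeft_mk, tmulLeft_mk]; rfl
      | add x y hx hy => rw [smul_add, map_add, map_add, hx, hy, smul_add])

variable (M N N') in
/-- Associativity of the tensor product. -/
def assoc : BalTensor A M (BalTensor A N N') ≃ₗ[Aᵐᵒᵖ] BalTensor A (BalTensor A M N) N' :=
  LinearEquiv.ofLinearMap (assocInvHom M N N') (assocHom M N N')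
    (by
      ext t z
      induction t using induction_on with
      | zero => simp
      | tmul n z => rfl
      | add x y hx hy => rw [map_add, AddMonoidHom.add_apply, map_add, map_add, hx, hy])
    (by
      ext m t
      induction t using induction_on with
      | zero => simp
      | tmul n z => rfl
      | add x y hx hy => rw [map_add, map_add, map_add, hx, hy])

theorem assoc_rMap (f : M →ₗ[Aᵐᵒᵖ] M') (t : BalTensor A M (BalTensor A N N')) :
    assoc M' N N' (rMap A (BalTensor A N N') f t) =
      rMap A N' (rMap A N f) (assoc M N N' t) := by
  induction t using induction_on with
  | zero => simp
  | tmul m t =>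
    induction t using induction_on with
    | zero => simp
    | tmul n z => rfl
    | add x y hx hy => rw [map_add, map_add, map_add, map_add, map_add, hx, hy]
  | add x y hx hy => rw [map_add, map_add, map_add, map_add, hx, hy]

theorem rid_rMap (f : M →ₗ[Aᵐᵒᵖ] M') (t : BalTensor A M A) :
    rid A M' (rMap A A f t) = f (rid A M t) := by
  induction t using induction_on with
  | zero => simp
  | tmul m a => exact (map_smul f (op a) m).symm
  | add x y hx hy => rw [map_add, map_add, map_add, map_add, hx, hy]

section DirectSum

-- Supplies the hypothesis of `eq_zero_of_components`. Allowing every set that contains the support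
-- lets two elements share one index set.
variable (A) in
theorem directSum_components {ι : Type*} [DecidableEq ι] (X : ι → Type*)
    [∀ i, AddCommGroup (X i)] [∀ i, Module Aᵐᵒᵖ (X i)] (m : ⨁ i, X i) :
    ∃ s : Finset ι, ∀ s', s ⊆ s' → ∑ i ∈ s', DirectSum.lof Aᵐᵒᵖ ι X i
      (DirectSum.component Aᵐᵒᵖ ι X i m) = m := by
  classical
  refine ⟨DFinsupp.support m, fun s' hs' => ?_⟩
  conv_rhs => rw [← DirectSum.sum_support_of m]
  refine (Finset.sum_subset hs' fun i _ hi => ?_).symm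
  have : DirectSum.component Aᵐᵒᵖ ι X i m = 0 := DFinsupp.notMem_support_iff.1 hi
  rw [this, map_zero]

variable {ι : Type u} [DecidableEq ι] (X : ι → Type u) [∀ i, AddCommGroup (X i)]
  [∀ i, Module Aᵐᵒᵖ (X i)]

variable (N) in
/-- The canonical map from the tensor product with a direct sum. -/
def directSumHom : BalTensor A (⨁ i, X i) N →ₗ[Aᵐᵒᵖ] ⨁ i, BalTensor A (X i) N :=
  liftLin (fun m n => DFinsupp.mapRange.addMonoidHom
      (fun i => (mk A (M := X i) (N := N)).flip n) m)
    (fun m m' n => map_add _ m m')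
    (fun m n n' => by
      ext i
      exact map_add (mk A (m i)) n n')
    (fun m a n => by
      ext i
      exact mk_smul A (m i) a n)
    (fun m b n => by
      ext i
      rfl)

theorem directSumHom_lof (i : ι) (x : X i) (n : N) :
    directSumHom N X (mk A (DirectSum.lof Aᵐᵒᵖ ι X i x) n) =
      DirectSum.lof Aᵐᵒᵖ ι (fun i => BalTensor A (X i) N) i (mk A x n) :=
  DFinsupp.mapRange_single (hf := fun i => by simp)

variable (N) in
/-- The tensor product commutes with direct sums. -/
def directSum : BalTensor A (⨁ i, X i) N ≃ₗ[Aᵐᵒᵖ] ⨁ i, BalTensor A (X i) N :=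
  LinearEquiv.ofLinearMap (directSumHom N X)
    (DirectSum.toModule Aᵐᵒᵖ ι _ fun i => rMap A N (DirectSum.lof Aᵐᵒᵖ ι X i))
    (by
      refine DirectSum.linearMap_ext _ fun i => ?_
      ext m n : 2
      rw [LinearMap.comp_apply, LinearMap.comp_apply, DirectSum.toModule_lof, rMap_mk,
        directSumHom_lof]
      rfl)
    (by
      ext m n
      induction m using DirectSum.induction_on with
      | zero => simp
      | of i x =>
        rw [LinearMap.comp_apply, ← DirectSum.lof_eq_of Aᵐᵒᵖ, directSumHom_lof,
          DirectSum.toModule_lof]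
        rfl
      | add x y hx hy => rw [map_add, AddMonoidHom.add_apply, map_add, hx, hy, map_add])

end DirectSum

end Isomorphisms

end BalTensor

/-! ### Vanishing of Tor and dimension shifting. -/

namespace BalTensor

variable {A : Type u} [Ring A]

/-- A short exact sequence of right modules. -/
structure ShortExactSeq {K Q N : Type u} [AddCommGroup K] [Module Aᵐᵒᵖ K] [AddCommGroup Q]
    [Module Aᵐᵒᵖ Q] [AddCommGroup N] [Module Aᵐᵒᵖ N] (f : K →ₗ[Aᵐᵒᵖ] Q) (g : Q →ₗ[Aᵐᵒᵖ] N) :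
    Prop where
  inj : Function.Injective f
  exact : Function.Exact f g
  surj : Function.Surjective g

variable (A) (B : Type u) [AddCommGroup B] [Module A B] [Module Aᵐᵒᵖ B] [SMulCommClass A Aᵐᵒᵖ B]

/-- `TorVanish A B k N` says that `Tor_i(N, B) = 0` for `1 ≤ i ≤ k`. -/
def TorVanish : ℕ → ∀ (N : Type u) [AddCommGroup N] [Module Aᵐᵒᵖ N], Prop
  | 0, _, _, _ => True
  | k + 1, N, _, _ => ∃ (P : ModuleCat.{u} Aᵐᵒᵖ) (p : P →ₗ[Aᵐᵒᵖ] N), Module.Projective Aᵐᵒᵖ P ∧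
      Function.Surjective p ∧ Function.Injective (rMap A B (LinearMap.ker p).subtype) ∧
      TorVanish k (LinearMap.ker p)

variable {A B}
variable {K P Q N : Type u} [AddCommGroup K] [Module Aᵐᵒᵖ K] [AddCommGroup Q]
    [Module Aᵐᵒᵖ Q] [AddCommGroup N] [Module Aᵐᵒᵖ N] [AddCommGroup P] [Module Aᵐᵒᵖ P]

theorem shortExactSeq_ker {g : Q →ₗ[Aᵐᵒᵖ] N} (hg : Function.Surjective g) :
    ShortExactSeq (LinearMap.ker g).subtype g :=
  ⟨Subtype.val_injective, LinearMap.exact_subtype_ker_map g, hg⟩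

/-- A four-lemma chase: an element killed by `a ⊗ B` dies in `K₃ ⊗ B` because `c ⊗ B` is injective,
so right exactness brings it from `K₁ ⊗ B`, where injectivity is assumed. -/
theorem injective_of_extension {K₁ K₂ K₃ P Q : Type u} [AddCommGroup K₁] [Module Aᵐᵒᵖ K₁]
    [AddCommGroup K₂] [Module Aᵐᵒᵖ K₂] [AddCommGroup K₃] [Module Aᵐᵒᵖ K₃]
    [AddCommGroup P] [Module Aᵐᵒᵖ P] [AddCommGroup Q] [Module Aᵐᵒᵖ Q]
    {i : K₁ →ₗ[Aᵐᵒᵖ] K₂} {q : K₂ →ₗ[Aᵐᵒᵖ] K₃} {a : K₂ →ₗ[Aᵐᵒᵖ] P} {c : K₃ →ₗ[Aᵐᵒᵖ] Q}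
    {r : P →ₗ[Aᵐᵒᵖ] Q} (hq : Function.Surjective q) (he : Function.Exact i q)
    (hc : Function.Injective (rMap A B c)) (hi : Function.Injective (rMap A B (a ∘ₗ i)))
    (h : c ∘ₗ q = r ∘ₗ a) : Function.Injective (rMap A B a) := by
  rw [injective_iff_map_eq_zero] at hc hi ⊢
  intro t ht
  have h1 : rMap A B q t = 0 := by
    apply hc
    rw [rMap_comp_apply, h, ← rMap_comp_apply, ht, map_zero]
  obtain ⟨s, rfl⟩ := (rMap_exact he hq t).1 h1
  rw [rMap_comp_apply] at ht
  rw [hi s ht, map_zero]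

/-- Given a surjection from a projective module with kernel `ker p` and an arbitrary short exact
sequence ending in the same module, one gets `0 → ker p → K × P → Q → 0`. -/
theorem exists_shortExactSeq [Module.Projective Aᵐᵒᵖ P] {f : K →ₗ[Aᵐᵒᵖ] Q} {g : Q →ₗ[Aᵐᵒᵖ] N}
    (h : ShortExactSeq f g) (p : P →ₗ[Aᵐᵒᵖ] N) (hp : Function.Surjective p) :
    ∃ (i : LinearMap.ker p →ₗ[Aᵐᵒᵖ] K × P) (r : K × P →ₗ[Aᵐᵒᵖ] Q), ShortExactSeq i r ∧
      r ∘ₗ LinearMap.inl _ _ _ = f ∧ LinearMap.snd _ _ _ ∘ₗ i = (LinearMap.ker p).subtype := by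
  obtain ⟨q, hq⟩ := Module.projective_lifting_property g p h.surj
  have hq' : ∀ b, g (q b) = p b := fun b => DFunLike.congr_fun hq b
  have hmem : ∀ b : LinearMap.ker p, -q b ∈ LinearMap.range f := fun b =>
    (h.exact _).1 (by rw [map_neg, hq', b.2, neg_zero])
  let e := LinearEquiv.ofInjective f h.inj
  -- The lift `q` of `p` sends `ker p` into the range of `f`. The sign is chosen so that `b ↦ (φ b,
  -- b)` lands in the kernel of `f.coprod q`.
  let φ : LinearMap.ker p →ₗ[Aᵐᵒᵖ] K := e.symm.toLinearMap ∘ₗ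
    LinearMap.codRestrict (LinearMap.range f) (-(q ∘ₗ (LinearMap.ker p).subtype)) hmem
  have hφ : ∀ b, f (φ b) = -q b := fun b =>
    congrArg Subtype.val (e.apply_symm_apply ⟨-q b, hmem b⟩)
  refine ⟨φ.prod (LinearMap.ker p).subtype, f.coprod q, ⟨?_, ?_, ?_⟩, ?_, ?_⟩
  · intro x y hxy
    exact Subtype.ext (congrArg Prod.snd hxy)
  · rintro ⟨k, b⟩
    constructor
    · intro hkb
      have hkb' : f k + q b = 0 := hkb
      have hb : b ∈ LinearMap.ker p := by
        have := congrArg g hkb'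
        rwa [map_add, h.exact.apply_apply_eq_zero, zero_add, hq', map_zero] at this
      refine ⟨⟨b, hb⟩, Prod.ext (h.inj ?_) rfl⟩
      exact (hφ ⟨b, hb⟩).trans (eq_neg_of_add_eq_zero_left hkb').symm
    · rintro ⟨b, hb⟩
      rw [← hb]
      change f (φ b) + q b = 0
      rw [hφ, neg_add_cancel]
  · intro y
    obtain ⟨b, hb⟩ := hp (g y)
    obtain ⟨k, hk⟩ := (h.exact (y - q b)).1 (by rw [map_sub, hq', hb, sub_self])
    exact ⟨(k, b), by simp [hk]⟩
  · ext k; simp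
  · rfl

/-- Independence of the cover chosen in `TorVanish`. An element of `K ⊗ B` killed in `Q ⊗ B` comes,
inside `(K × P) ⊗ B`, from `ker p ⊗ B`; its `P`-component is zero and `ker p ⊗ B` injects into `P ⊗
B`, so it vanishes. -/
theorem TorVanish.injective (hN : TorVanish A B 1 N) {f : K →ₗ[Aᵐᵒᵖ] Q} {g : Q →ₗ[Aᵐᵒᵖ] N}
    (h : ShortExactSeq f g) : Function.Injective (rMap A B f) := by
  obtain ⟨P, p, hP, hp, hinj, -⟩ := hN
  obtain ⟨i, r, hir, hf, hi⟩ := exists_shortExactSeq h p hp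
  rw [injective_iff_map_eq_zero] at hinj ⊢
  intro t ht
  rw [← hf, ← rMap_comp_apply] at ht
  obtain ⟨s, hs⟩ := (rMap_exact hir.exact hir.surj _).1 ht
  have hs0 : s = 0 := by
    apply hinj
    rw [← hi, ← rMap_comp_apply, hs, rMap_comp_apply, LinearMap.snd_comp_inl, rMap_zero]
    rfl
  have : Function.Injective (rMap A B (LinearMap.inl Aᵐᵒᵖ K P)) :=
    rMap_injective_of_leftInverse (g := LinearMap.fst _ _ _) (LinearMap.fst_comp_inl _ _ _)
  exact this (by rw [← hs, hs0, map_zero, map_zero])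

theorem TorVanish.of_succ {k : ℕ} : ∀ {N : Type u} [AddCommGroup N] [Module Aᵐᵒᵖ N],
    TorVanish A B (k + 1) N → TorVanish A B k N := by
  induction k with
  | zero => intro N _ _ _; trivial
  | succ k ih =>
    rintro N _ _ ⟨P, p, hP, hp, hinj, h⟩
    exact ⟨P, p, hP, hp, hinj, ih h⟩

theorem TorVanish.of_subsingleton [Subsingleton N] (k : ℕ) : TorVanish A B k N := by
  have h : ∀ (k : ℕ) (N : Type u) [AddCommGroup N] [Module Aᵐᵒᵖ N] [Subsingleton N],
      TorVanish A B k N := by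
    intro k
    induction k with
    | zero => intros; trivial
    | succ k ih =>
      intro N _ _ _
      refine ⟨ModuleCat.of Aᵐᵒᵖ PUnit, 0, inferInstance, fun x => ⟨0, Subsingleton.elim _ _⟩,
        rMap_injective_of_leftInverse (g := 0) ?_, ih _⟩
      exact LinearMap.ext fun x => Subsingleton.elim _ _
  exact h k N

theorem TorVanish.of_projective [Module.Projective Aᵐᵒᵖ N] (k : ℕ) : TorVanish A B k N := by
  cases k with
  | zero => trivial
  | succ k =>
    have : Subsingleton (LinearMap.ker (LinearMap.id : N →ₗ[Aᵐᵒᵖ] N)) := by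
      rw [LinearMap.ker_id]; infer_instance
    refine ⟨ModuleCat.of Aᵐᵒᵖ N, LinearMap.id, ‹_›, Function.surjective_id,
        rMap_injective_of_leftInverse (g := 0) ?_, .of_subsingleton _⟩
    exact LinearMap.ext fun x => Subsingleton.elim _ _

/-- The horseshoe lemma: projective covers of the two ends give the cover `P × R` of the middle, and
the three kernels again form a short exact sequence, to which the induction applies. -/
theorem TorVanish.extension {k : ℕ} : ∀ {X Y Z : Type u} [AddCommGroup X] [Module Aᵐᵒᵖ X]
    [AddCommGroup Y] [Module Aᵐᵒᵖ Y] [AddCommGroup Z] [Module Aᵐᵒᵖ Z]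
    {f : X →ₗ[Aᵐᵒᵖ] Y} {g : Y →ₗ[Aᵐᵒᵖ] Z}, ShortExactSeq f g →
    TorVanish A B k X → TorVanish A B k Z → TorVanish A B k Y := by
  induction k with
  | zero => intros; trivial
  | succ k ih =>
    rintro X Y Z _ _ _ _ _ _ f g h ⟨P, p, hP, hp, hpi, hpk⟩ ⟨R, r, hR, hr, hri, hrk⟩
    obtain ⟨q, hq⟩ := Module.projective_lifting_property g r h.surj
    have hq' : ∀ b, g (q b) = r b := fun b => DFunLike.congr_fun hq b
    let s : P × R →ₗ[Aᵐᵒᵖ] Y := (f ∘ₗ p).coprod q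
    have hs : ∀ a b, s (a, b) = f (p a) + q b := fun a b => rfl
    have hgs : ∀ a b, g (s (a, b)) = r b := fun a b => by
      rw [hs, map_add, h.exact.apply_apply_eq_zero, zero_add, hq']
    let i : LinearMap.ker p →ₗ[Aᵐᵒᵖ] LinearMap.ker s :=
      LinearMap.codRestrict _ (LinearMap.inl _ _ _ ∘ₗ (LinearMap.ker p).subtype) (fun a => by
        change s (a.1, 0) = 0
        rw [hs, a.2, map_zero, map_zero, add_zero])
    let j : LinearMap.ker s →ₗ[Aᵐᵒᵖ] LinearMap.ker r :=
      LinearMap.codRestrict _ (LinearMap.snd _ _ _ ∘ₗ (LinearMap.ker s).subtype) (fun a => by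
        change r a.1.2 = 0
        rw [← hgs a.1.1, show s (a.1.1, a.1.2) = 0 from a.2, map_zero])
    have hij : ShortExactSeq i j := by
      refine ⟨?_, ?_, ?_⟩
      · intro a b hab
        exact Subtype.ext (congrArg (fun x => x.1.1) hab)
      · rintro ⟨⟨a, b⟩, hab⟩
        constructor
        · intro h0
          obtain rfl : b = 0 := congrArg Subtype.val h0
          refine ⟨⟨a, h.inj ?_⟩, rfl⟩
          have : f (p a) + q 0 = 0 := hab
          rw [map_zero, add_zero] at this
          rw [this, map_zero]
        · rintro ⟨c, hc⟩
          rw [← hc]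
          rfl
      · rintro ⟨b, hb⟩
        obtain ⟨x, hx⟩ := (h.exact (q b)).1 (by rw [hq', hb])
        obtain ⟨a, rfl⟩ := hp x
        refine ⟨⟨(-a, b), ?_⟩, rfl⟩
        change f (p (-a)) + q b = 0
        rw [map_neg, map_neg, hx, neg_add_cancel]
    refine ⟨ModuleCat.of Aᵐᵒᵖ (P × R), s, inferInstanceAs (Module.Projective Aᵐᵒᵖ (P × R)),
      ?_, ?_, ih hij hpk hrk⟩
    · intro y
      obtain ⟨b, hb⟩ := hr (g y)
      obtain ⟨x, hx⟩ := (h.exact (y - q b)).1 (by rw [map_sub, hq', hb, sub_self])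
      obtain ⟨a, rfl⟩ := hp x
      exact ⟨(a, b), by rw [hs, hx, sub_add_cancel]⟩
    · refine injective_of_extension (r := LinearMap.snd _ _ _) hij.surj hij.exact hri ?_ rfl
      have : (LinearMap.ker s).subtype ∘ₗ i =
        LinearMap.inl _ _ _ ∘ₗ (LinearMap.ker p).subtype := rfl
      rw [this, rMap_comp]
      exact (rMap_injective_of_leftInverse (g := LinearMap.fst _ _ _)
        (LinearMap.fst_comp_inl _ _ _)).comp hpi

/-- Replaces the long exact sequence: for a cover `p` of `Q`, the kernel of the composite cover `g ∘
p` of `N` is an extension of `K` by `ker p`. The hypothesis `hf` accounts for `Tor_1`. -/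
theorem TorVanish.quotient {k : ℕ} {f : K →ₗ[Aᵐᵒᵖ] Q} {g : Q →ₗ[Aᵐᵒᵖ] N}
    (h : ShortExactSeq f g) (hQ : TorVanish A B (k + 1) Q) (hK : TorVanish A B k K)
    (hf : Function.Injective (rMap A B f)) : TorVanish A B (k + 1) N := by
  obtain ⟨P, p, hP, hp, hpi, hpk⟩ := hQ
  let i : LinearMap.ker p →ₗ[Aᵐᵒᵖ] LinearMap.ker (g ∘ₗ p) :=
    Submodule.inclusion (LinearMap.ker_le_ker_comp p g)
  let e := LinearEquiv.ofInjective f h.inj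
  have hmem : ∀ b : LinearMap.ker (g ∘ₗ p), p b ∈ LinearMap.range f := fun b =>
    (h.exact _).1 b.2
  let j : LinearMap.ker (g ∘ₗ p) →ₗ[Aᵐᵒᵖ] K := e.symm.toLinearMap ∘ₗ
    LinearMap.codRestrict (LinearMap.range f) (p ∘ₗ (LinearMap.ker (g ∘ₗ p)).subtype) hmem
  have hj : ∀ b, f (j b) = p b := fun b =>
    congrArg Subtype.val (e.apply_symm_apply ⟨p b, hmem b⟩)
  have hij : ShortExactSeq i j := by
    refine ⟨Submodule.inclusion_injective _, fun b => ⟨fun hb => ?_, ?_⟩, fun x => ?_⟩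
    · refine ⟨⟨b.1, ?_⟩, rfl⟩
      rw [LinearMap.mem_ker, ← hj, hb, map_zero]
    · rintro ⟨a, rfl⟩
      apply h.inj
      rw [hj, map_zero]
      exact a.2
    · obtain ⟨b, hb⟩ := hp (f x)
      have hb' : b ∈ LinearMap.ker (g ∘ₗ p) := by
        rw [LinearMap.mem_ker, LinearMap.comp_apply, hb, h.exact.apply_apply_eq_zero]
      exact ⟨⟨b, hb'⟩, h.inj ((hj _).trans hb)⟩
  refine ⟨P, g ∘ₗ p, hP, h.surj.comp hp, ?_, .extension hij hpk hK⟩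
  exact injective_of_extension (r := p) hij.surj hij.exact hf hpi (LinearMap.ext hj)

/-- `N` is the quotient of `Y` by `ker r`, itself a retract of `Y`. The quotient lemma needs one Tor
degree less for `ker r`, so induction on `k` closes. -/
theorem TorVanish.retract {k : ℕ} : ∀ {N Y : Type u} [AddCommGroup N] [Module Aᵐᵒᵖ N]
    [AddCommGroup Y] [Module Aᵐᵒᵖ Y] (i : N →ₗ[Aᵐᵒᵖ] Y) (r : Y →ₗ[Aᵐᵒᵖ] N),
    r ∘ₗ i = LinearMap.id → TorVanish A B k Y → TorVanish A B k N := by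
  induction k with
  | zero => intros; trivial
  | succ k ih =>
    intro N Y _ _ _ _ i r hir hY
    have hir' : ∀ x, r (i x) = x := DFunLike.congr_fun hir
    let s : Y →ₗ[Aᵐᵒᵖ] LinearMap.ker r := LinearMap.codRestrict _ (LinearMap.id - i ∘ₗ r)
      (fun y => by simp [hir'])
    have hs : s ∘ₗ (LinearMap.ker r).subtype = LinearMap.id := by
      ext y
      simp [s]
    exact .quotient (shortExactSeq_ker fun x => ⟨i x, hir' x⟩) hY (ih _ _ hs hY.of_succ)
      (rMap_injective_of_leftInverse hs)

theorem TorVanish.congr {k : ℕ} (e : Q ≃ₗ[Aᵐᵒᵖ] N) (h : TorVanish A B k Q) : TorVanish A B k N :=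
  h.retract e.symm.toLinearMap e.toLinearMap (by ext; simp)

/-- With a projective cover `p : P → N`, the module `K × P` is an extension of `Q` by `ker p`, and
`K` is a retract of it. -/
theorem TorVanish.kernel {k : ℕ} {f : K →ₗ[Aᵐᵒᵖ] Q} {g : Q →ₗ[Aᵐᵒᵖ] N}
    (h : ShortExactSeq f g) (hN : TorVanish A B (k + 1) N) (hQ : TorVanish A B k Q) :
    TorVanish A B k K := by
  obtain ⟨P, p, hP, hp, -, hpk⟩ := hN
  obtain ⟨i, r, hir, -, -⟩ := exists_shortExactSeq h p hp
  exact (TorVanish.extension hir hpk hQ).retract (LinearMap.inl _ _ _) (LinearMap.fst _ _ _)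
    (LinearMap.fst_comp_inl _ _ _)

section DirectSum

variable {ι : Type u}

theorem shortExactSeq_directSum {K Q N : ι → Type u} [∀ i, AddCommGroup (K i)]
    [∀ i, Module Aᵐᵒᵖ (K i)] [∀ i, AddCommGroup (Q i)] [∀ i, Module Aᵐᵒᵖ (Q i)]
    [∀ i, AddCommGroup (N i)] [∀ i, Module Aᵐᵒᵖ (N i)] {f : ∀ i, K i →ₗ[Aᵐᵒᵖ] Q i}
    {g : ∀ i, Q i →ₗ[Aᵐᵒᵖ] N i} (h : ∀ i, ShortExactSeq (f i) (g i)) :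
    ShortExactSeq (K := ⨁ i, K i) (Q := ⨁ i, Q i) (N := ⨁ i, N i)
      (DFinsupp.mapRange.linearMap f) (DFinsupp.mapRange.linearMap g) := by
  classical
  refine ⟨?_, fun y => ⟨fun hy => ?_, ?_⟩, ?_⟩
  · exact (DFinsupp.mapRange_injective _ fun i => map_zero _).2 fun i => (h i).inj
  -- The default value outside the range is never used; injectivity forces `s i 0 = 0`, which
  -- `DFinsupp.mapRange` requires.
  · let s : ∀ i, Q i → K i := fun i y => if hy : ∃ x, f i x = y then hy.choose else 0
    have hs : ∀ i y, g i y = 0 → f i (s i y) = y := by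
      intro i y hy
      have hy' : ∃ x, f i x = y := ((h i).exact y).1 hy
      simp only [s, dif_pos hy']
      exact hy'.choose_spec
    refine ⟨DFinsupp.mapRange s (fun i => (h i).inj ?_) y, ?_⟩
    · rw [hs _ _ (map_zero _), map_zero]
    · refine DFinsupp.ext fun i => hs i _ ?_
      exact DFunLike.congr_fun hy i
  · rintro ⟨x, rfl⟩
    refine DFinsupp.ext fun i => ?_
    exact (h i).exact.apply_apply_eq_zero _
  · exact (DFinsupp.mapRange_surjective _ fun i => map_zero _).2 fun i => (h i).surj

-- The direct sum of the chosen covers is a projective cover of the direct sum, and injectivity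
-- after tensoring is checked on components.
variable [DecidableEq ι] in
theorem TorVanish.directSum {k : ℕ} : ∀ {X : ι → Type u} [∀ i, AddCommGroup (X i)]
    [∀ i, Module Aᵐᵒᵖ (X i)], (∀ i, TorVanish A B k (X i)) → TorVanish A B k (⨁ i, X i) := by
  induction k with
  | zero => intros; trivial
  | succ k ih =>
    intro X _ _ h
    choose P p hP hp hpi hpk using h
    have hse := shortExactSeq_directSum fun i => shortExactSeq_ker (hp i)
    have : Module.Projective Aᵐᵒᵖ (⨁ i, P i) := inferInstance
    refine .quotient hse (.of_projective _) (ih hpk) ?_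
    rw [injective_iff_map_eq_zero]
    intro t ht
    refine eq_zero_of_components _ _ (directSum_components A _) t fun i => ?_
    refine (injective_iff_map_eq_zero _).1 (hpi i) _ ?_
    have := congrArg (rMap A B (DirectSum.component Aᵐᵒᵖ ι (fun i => (P i : Type u)) i)) ht
    rw [rMap_comp_apply, map_zero] at this
    rw [rMap_comp_apply]
    exact this

theorem TorVanish.pi {n k : ℕ} {X : Fin n → Type u} [∀ i, AddCommGroup (X i)]
    [∀ i, Module Aᵐᵒᵖ (X i)] (h : ∀ i, TorVanish A B k (X i)) : TorVanish A B k (∀ i, X i) := by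
  -- Direct sums here are indexed by types in universe `u`, hence the lift of `Fin n`.
  have h1 := TorVanish.directSum (ι := ULift.{u} (Fin n)) (X := fun i => X i.down)
    fun i => h i.down
  have e := DirectSum.linearEquivFunOnFintype Aᵐᵒᵖ (ULift.{u} (Fin n)) (fun i => X i.down)
  exact h1.congr (e.trans (LinearEquiv.piCongrLeft Aᵐᵒᵖ X Equiv.ulift))

end DirectSum

end BalTensor

/-! ### Acyclic resolutions. -/

namespace BalTensor

variable {A : Type u} [Ring A]
variable {B : Type u} [AddCommGroup B] [Module A B] [Module Aᵐᵒᵖ B] [SMulCommClass A Aᵐᵒᵖ B]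

/-- Drops the first term of a resolution: what remains resolves the first syzygy `ker p`. This
drives the two inductions below. -/
theorem exact_codRestrict_ker {P₀ P₁ P₂ N : Type u} [AddCommGroup P₀] [Module Aᵐᵒᵖ P₀]
    [AddCommGroup P₁] [Module Aᵐᵒᵖ P₁] [AddCommGroup P₂] [Module Aᵐᵒᵖ P₂]
    [AddCommGroup N] [Module Aᵐᵒᵖ N] {d₁ : P₂ →ₗ[Aᵐᵒᵖ] P₁} {d₀ : P₁ →ₗ[Aᵐᵒᵖ] P₀}
    {p : P₀ →ₗ[Aᵐᵒᵖ] N} (h₁ : Function.Exact d₁ d₀) (h₀ : Function.Exact d₀ p) :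
    Function.Exact d₁ (LinearMap.codRestrict (LinearMap.ker p) d₀ h₀.apply_apply_eq_zero) ∧
    Function.Surjective (LinearMap.codRestrict (LinearMap.ker p) d₀ h₀.apply_apply_eq_zero) := by
  constructor
  · intro x
    rw [← h₁ x]
    exact Subtype.ext_iff
  · rintro ⟨x, hx⟩
    obtain ⟨y, hy⟩ := (h₀ x).1 hx
    exact ⟨y, Subtype.ext hy⟩

/-- A module with an acyclic resolution which stays exact after tensoring is acyclic. -/
theorem TorVanish.of_resolution {k : ℕ} : ∀ {P : ℕ → ModuleCat.{u} Aᵐᵒᵖ} {N : Type u}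
    [AddCommGroup N] [Module Aᵐᵒᵖ N] (d : ∀ n, P (n + 1) →ₗ[Aᵐᵒᵖ] P n) (p : P 0 →ₗ[Aᵐᵒᵖ] N),
    (∀ n k, TorVanish A B k (P n)) → (∀ n, Function.Exact (d (n + 1)) (d n)) →
    Function.Exact (d 0) p → Function.Surjective p →
    (∀ n, Function.Exact (rMap A B (d (n + 1))) (rMap A B (d n))) → TorVanish A B k N := by
  induction k with
  | zero => intros; trivial
  | succ k ih =>
    intro P N _ _ d p hP hd h0 hp hB
    obtain ⟨he, hs⟩ := exact_codRestrict_ker (hd 0) h0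
    have hK : TorVanish A B k (LinearMap.ker p) :=
      ih (P := fun n => P (n + 1)) (fun n => d (n + 1)) _ (fun n => hP _) (fun n => hd _) he hs
        (fun n => hB _)
    refine .quotient (shortExactSeq_ker hp) (hP 0 _) hK ?_
    -- Injectivity of `ker p ⊗ B → P₀ ⊗ B`: a kernel element lifts to a cycle in `P₁ ⊗ B`, which is
    -- a boundary by `hB` and so is zero in `ker p ⊗ B`.
    rw [injective_iff_map_eq_zero]
    intro t ht
    obtain ⟨s, rfl⟩ := rMap_surjective hs t
    rw [rMap_comp_apply] at ht
    obtain ⟨r, rfl⟩ := (hB 0 s).1 ht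
    rw [rMap_comp_apply, he.linearMap_comp_eq_zero, rMap_zero]
    rfl

/-- An acyclic resolution of an acyclic module stays exact after tensoring. -/
theorem exact_rMap_of_torVanish (n : ℕ) : ∀ {P : ℕ → ModuleCat.{u} Aᵐᵒᵖ} {N : Type u}
    [AddCommGroup N] [Module Aᵐᵒᵖ N] (d : ∀ n, P (n + 1) →ₗ[Aᵐᵒᵖ] P n) (p : P 0 →ₗ[Aᵐᵒᵖ] N),
    (∀ n k, TorVanish A B k (P n)) → (∀ n, Function.Exact (d (n + 1)) (d n)) →
    Function.Exact (d 0) p → Function.Surjective p → (∀ k, TorVanish A B k N) →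
    Function.Exact (rMap A B (d (n + 1))) (rMap A B (d n)) := by
  induction n with
  | zero =>
    intro P N _ _ d p hP hd h0 hp hN t
    obtain ⟨he, hs⟩ := exact_codRestrict_ker (hd 0) h0
    -- Since `ker p ⊗ B` injects into `P₀ ⊗ B`, corestricting `d 0` to `ker p` does not change the
    -- kernel after tensoring, and right exactness applies.
    refine Iff.trans ?_ (rMap_exact he hs t)
    rw [← map_eq_zero_iff _ ((hN 1).injective (shortExactSeq_ker hp)), rMap_comp_apply]
    rfl
  | succ n ih =>
    intro P N _ _ d p hP hd h0 hp hN
    obtain ⟨he, hs⟩ := exact_codRestrict_ker (hd 0) h0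
    exact ih (P := fun n => P (n + 1)) (fun n => d (n + 1)) _ (fun n => hP _) (fun n => hd _)
      he hs (fun k => .kernel (shortExactSeq_ker hp) (hN _) (hP _ _))

end BalTensor

/-! ### Purity of derived tensor products in terms of Tor. -/

namespace RingBimod

open BalTensor DerivedTensor

variable {A : Type u} [Ring A]

/-- An augmentation of a complex in nonnegative degrees which identifies its homology in degree
`0` with `N`. -/
structure IsAugmentation {N : Type u} [AddCommGroup N] [Module Aᵐᵒᵖ N]
    (X : ChainComplex (ModuleCat.{u} Aᵐᵒᵖ) ℕ) (p : X.X 0 →ₗ[Aᵐᵒᵖ] N) : Prop where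
  surj : Function.Surjective p
  exact : Function.Exact (X.d 1 0).hom p

theorem exactAt_succ_iff (X : ChainComplex (ModuleCat.{u} Aᵐᵒᵖ) ℕ) (n : ℕ) :
    X.ExactAt (n + 1) ↔ Function.Exact (X.d (n + 1 + 1) (n + 1)).hom (X.d (n + 1) n).hom := by
  rw [X.exactAt_iff' (n + 1 + 1) (n + 1) n (by simp) (by simp),
    ShortComplex.ShortExact.moduleCat_exact_iff_function_exact]
  rfl

theorem isPure_iff (X : ChainComplex (ModuleCat.{u} Aᵐᵒᵖ) ℕ) :
    IsPure X ↔ ∀ n, Function.Exact (X.d (n + 1 + 1) (n + 1)).hom (X.d (n + 1) n).hom := by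
  constructor
  · exact fun h n => (exactAt_succ_iff X n).1 (h _ n.succ_ne_zero)
  · intro h i hi
    obtain ⟨n, rfl⟩ := Nat.exists_eq_succ_of_ne_zero hi
    exact (exactAt_succ_iff X n).2 (h n)

theorem pOpcycles_eq_zero_iff (X : ChainComplex (ModuleCat.{u} Aᵐᵒᵖ) ℕ) (x : X.X 0) :
    (X.pOpcycles 0).hom x = 0 ↔ ∃ y, (X.d 1 0).hom y = x := by
  have h := ShortComplex.exact_of_g_is_cokernel
    (ShortComplex.mk (X.d 1 0) (X.pOpcycles 0) (by simp))
    (X.opcyclesIsCokernel 1 0 (by simp))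
  rw [ShortComplex.ShortExact.moduleCat_exact_iff_function_exact] at h
  exact h x

/-- In degree 0 of a complex in nonnegative degrees every element is a cycle, so the opcycles are
the homology. -/
theorem isIso_opcyclesMap {X Y : ChainComplex (ModuleCat.{u} Aᵐᵒᵖ) ℕ} (f : X ⟶ Y) [QuasiIso f] :
    IsIso (HomologicalComplex.opcyclesMap f 0) := by
  have h := HomologicalComplex.homologyι_naturality f 0
  have e : HomologicalComplex.opcyclesMap f 0 =
      inv (X.homologyι 0) ≫ HomologicalComplex.homologyMap f 0 ≫ Y.homologyι 0 := by
    rw [h, IsIso.inv_hom_id_assoc]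
  rw [e]
  infer_instance

theorem IsAugmentation.of_quasiIso {N : Type u} [AddCommGroup N] [Module Aᵐᵒᵖ N]
    {X Y : ChainComplex (ModuleCat.{u} Aᵐᵒᵖ) ℕ} (f : X ⟶ Y) [QuasiIso f]
    {p : Y.X 0 →ₗ[Aᵐᵒᵖ] N} (hp : IsAugmentation Y p) :
    IsAugmentation X (p ∘ₗ (f.f 0).hom) := by
  have hiso := isIso_opcyclesMap f
  have hbij := (ConcreteCategory.isIso_iff_bijective _).1 hiso
  have hcomm : ∀ x : X.X 0, (HomologicalComplex.opcyclesMap f 0).hom ((X.pOpcycles 0).hom x) =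
      (Y.pOpcycles 0).hom ((f.f 0).hom x) := fun x =>
    ConcreteCategory.congr_hom (HomologicalComplex.p_opcyclesMap f 0) x
  have hsurj : Function.Surjective (X.pOpcycles 0).hom :=
    (ModuleCat.epi_iff_surjective _).1 inferInstance
  constructor
  · intro y
    obtain ⟨x, rfl⟩ := hp.surj y
    obtain ⟨z, hz⟩ := hbij.2 ((Y.pOpcycles 0).hom x)
    obtain ⟨r, rfl⟩ := hsurj z
    refine ⟨r, ?_⟩
    rw [LinearMap.comp_apply, ← sub_eq_zero, ← map_sub]
    refine (hp.exact _).2 ((pOpcycles_eq_zero_iff _ _).1 ?_)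
    rw [map_sub, ← hcomm, sub_eq_zero]
    exact hz
  · intro x
    rw [LinearMap.comp_apply, hp.exact]
    refine Iff.trans (pOpcycles_eq_zero_iff Y _).symm (Iff.trans ?_ (pOpcycles_eq_zero_iff X x))
    rw [← hcomm]
    exact map_eq_zero_iff _ hbij.1

theorem IsPure.of_quasiIso {X Y : ChainComplex (ModuleCat.{u} Aᵐᵒᵖ) ℕ} (f : X ⟶ Y) [QuasiIso f]
    (h : IsPure Y) : IsPure X := by
  intro i hi
  rw [HomologicalComplex.exactAt_iff_isZero_homology]
  exact ((h i hi).isZero_homology).of_iso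
    (asIso (HomologicalComplex.homologyMap f i))

/-- The complexes `X ⊗^L B` for a pure `X` are computed by a projective resolution of the homology
of `X` in degree `0`. -/
theorem exists_derivedTensor_eq {N : Type u} [AddCommGroup N] [Module Aᵐᵒᵖ N]
    {X : ChainComplex (ModuleCat.{u} Aᵐᵒᵖ) ℕ} {p : X.X 0 →ₗ[Aᵐᵒᵖ] N} (hp : IsAugmentation X p)
    (hX : IsPure X) : ∃ (P : ChainComplex (ModuleCat.{u} Aᵐᵒᵖ) ℕ) (q : P.X 0 →ₗ[Aᵐᵒᵖ] N),
      IsAugmentation P q ∧ IsPure P ∧ (∀ n, Module.Projective Aᵐᵒᵖ (P.X n)) ∧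
      ∀ B : RingBimod A, derivedTensor X B = (B.tensorRight.mapHomologicalComplex _).obj P := by
  let R := Classical.choice (DerivedTensor.nonempty_complexResolution X)
  have := R.quasiIso
  -- The chosen resolution depends on `X` only, so one `P` serves every bimodule `B`; this allows
  -- comparing `σ^n` with `σ^(n+1)` later.
  exact ⟨R.complex, _, hp.of_quasiIso R.π, IsPure.of_quasiIso R.π hX,
    fun n => (IsProjective.iff_projective _).2 (R.projective n), fun B => rfl⟩

theorem isPure_single (M : ModuleCat.{u} Aᵐᵒᵖ) : IsPure ((ChainComplex.single₀ _).obj M) :=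
  fun _ hi => HomologicalComplex.exactAt_single_obj _ _ _ _ hi

theorem isAugmentation_single (M : ModuleCat.{u} Aᵐᵒᵖ) :
    IsAugmentation ((ChainComplex.single₀ _).obj M) (LinearMap.id : M →ₗ[Aᵐᵒᵖ] M) := by
  refine ⟨Function.surjective_id, fun x => ?_⟩
  have : ((ChainComplex.single₀ _).obj M).d 1 0 = 0 := rfl
  rw [this]
  exact ⟨fun h => ⟨0, h.symm⟩, fun ⟨_, h⟩ => h.symm⟩

theorem IsAugmentation.congr {N N' : Type u} [AddCommGroup N] [Module Aᵐᵒᵖ N] [AddCommGroup N']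
    [Module Aᵐᵒᵖ N'] {X : ChainComplex (ModuleCat.{u} Aᵐᵒᵖ) ℕ} {p : X.X 0 →ₗ[Aᵐᵒᵖ] N}
    (hp : IsAugmentation X p) (e : N ≃ₗ[Aᵐᵒᵖ] N') : IsAugmentation X (e.toLinearMap ∘ₗ p) :=
  ⟨e.surjective.comp hp.surj, fun x => (map_eq_zero_iff e e.injective).trans (hp.exact x)⟩

theorem IsAugmentation.tensor {N : Type u} [AddCommGroup N] [Module Aᵐᵒᵖ N]
    {X : ChainComplex (ModuleCat.{u} Aᵐᵒᵖ) ℕ} {p : X.X 0 →ₗ[Aᵐᵒᵖ] N}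
    (hp : IsAugmentation X p) (B : RingBimod A) :
    IsAugmentation ((B.tensorRight.mapHomologicalComplex _).obj X) (rMap A B p) :=
  ⟨rMap_surjective hp.surj, rMap_exact hp.exact hp.surj⟩

theorem isPure_tensor_iff (X : ChainComplex (ModuleCat.{u} Aᵐᵒᵖ) ℕ) (B : RingBimod A) :
    IsPure ((B.tensorRight.mapHomologicalComplex _).obj X) ↔ ∀ n, Function.Exact
      (rMap A B (X.d (n + 1 + 1) (n + 1)).hom) (rMap A B (X.d (n + 1) n).hom) :=
  isPure_iff _

variable (A) in
/-- The ring `A` as a free right module. -/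
def opEquiv : Aᵐᵒᵖ ≃ₗ[Aᵐᵒᵖ] A where
  toFun := MulOpposite.unop
  invFun := op
  map_add' _ _ := rfl
  map_smul' _ _ := rfl

instance : Module.Projective Aᵐᵒᵖ A := .of_equiv (opEquiv A)

theorem torVanish_regular (B : RingBimod A) (k : ℕ) : TorVanish A B k A := .of_projective k

variable {σ : RingBimod A}

/-- By purity each derived power may be replaced by a projective resolution of its degree 0
homology, and right exactness computes that homology after one more tensor factor. -/
theorem exists_isAugmentation_derivedPow (hpure : ∀ n : ℕ, 1 ≤ n → IsPure (σ.derivedPow n)) :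
    ∀ n : ℕ, ∃ p : (σ.derivedPow (n + 1)).X 0 →ₗ[Aᵐᵒᵖ] σ.pow (n + 1),
      IsAugmentation (σ.derivedPow (n + 1)) p
  -- `pow 1` is `A ⊗ σ`, whereas `derivedPow 1` is `σ` itself.
  | 0 => ⟨_, (isAugmentation_single (toRight σ)).congr (lid A σ).symm⟩
  | n + 1 => by
    obtain ⟨p, hp⟩ := exists_isAugmentation_derivedPow hpure n
    obtain ⟨P, q, hq, -, -, hP⟩ := exists_derivedTensor_eq hp (hpure _ n.succ_pos)
    have h : σ.derivedPow (n + 1 + 1) = _ := hP σ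
    rw [h]
    exact ⟨_, hq.tensor σ⟩

/-- Purity of the next derived power says that a projective resolution of `σ^(n+1)` stays exact
after tensoring with `σ`. -/
theorem torVanish_pow (hpure : ∀ n : ℕ, 1 ≤ n → IsPure (σ.derivedPow n)) (k : ℕ) :
    ∀ n : ℕ, TorVanish A σ k (σ.pow n)
  | 0 => torVanish_regular σ k
  | n + 1 => by
    obtain ⟨p, hp⟩ := exists_isAugmentation_derivedPow hpure n
    obtain ⟨P, q, hq, hPp, hPj, hP⟩ := exists_derivedTensor_eq hp (hpure _ n.succ_pos)
    have h : σ.derivedPow (n + 1 + 1) = _ := hP σ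
    have h2 := hpure (n + 1 + 1) (Nat.succ_pos _)
    rw [h, isPure_tensor_iff] at h2
    exact .of_resolution (P := P.X) (fun n => (P.d (n + 1) n).hom) q
      (fun n k => .of_projective k) ((isPure_iff P).1 hPp) hq.exact hq.surj h2

/-- `P` is a summand of a free module, so `P ⊗ B` is a summand of a direct sum of copies of `B`. -/
theorem torVanish_tensor_of_projective {B C : RingBimod A} {k : ℕ} (hB : TorVanish A C k B)
    (P : Type u) [AddCommGroup P] [Module Aᵐᵒᵖ P] [Module.Projective Aᵐᵒᵖ P] :
    TorVanish A C k (BalTensor A P B) := by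
  classical
  obtain ⟨s, hs⟩ := Module.projective_def'.1 ‹Module.Projective Aᵐᵒᵖ P›
  let e := finsuppLEquivDirectSum Aᵐᵒᵖ Aᵐᵒᵖ P
  have h1 : TorVanish A C k (⨁ _ : P, BalTensor A Aᵐᵒᵖ B) :=
    .directSum fun _ => hB.congr ((lid A B).symm.trans (rCongr (opEquiv A).symm))
  have h2 : TorVanish A C k (BalTensor A (P →₀ Aᵐᵒᵖ) B) :=
    h1.congr ((rCongr e).trans (BalTensor.directSum B fun _ : P => Aᵐᵒᵖ)).symm
  refine h2.retract (rMap A B s) (rMap A B (Finsupp.linearCombination Aᵐᵒᵖ id)) ?_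
  rw [← rMap_comp, hs, rMap_id]

theorem exact_rMap_pow_succ_iff {X Y Z : Type u} [AddCommGroup X] [Module Aᵐᵒᵖ X]
    [AddCommGroup Y] [Module Aᵐᵒᵖ Y] [AddCommGroup Z] [Module Aᵐᵒᵖ Z]
    (f : X →ₗ[Aᵐᵒᵖ] Y) (g : Y →ₗ[Aᵐᵒᵖ] Z) (n : ℕ) :
    Function.Exact (rMap A (σ.pow (n + 1)) f) (rMap A (σ.pow (n + 1)) g) ↔
      Function.Exact (rMap A σ (rMap A (σ.pow n) f)) (rMap A σ (rMap A (σ.pow n) g)) :=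
  (Function.Exact.iff_of_ladder_linearEquiv (e₁ := assoc X (σ.pow n) σ)
    (e₂ := assoc Y (σ.pow n) σ) (e₃ := assoc Z (σ.pow n) σ)
    (LinearMap.ext fun t => (assoc_rMap f t).symm)
    (LinearMap.ext fun t => (assoc_rMap g t).symm)).symm

theorem exact_rMap_pow_zero_iff {X Y Z : Type u} [AddCommGroup X] [Module Aᵐᵒᵖ X]
    [AddCommGroup Y] [Module Aᵐᵒᵖ Y] [AddCommGroup Z] [Module Aᵐᵒᵖ Z]
    (f : X →ₗ[Aᵐᵒᵖ] Y) (g : Y →ₗ[Aᵐᵒᵖ] Z) :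
    Function.Exact (rMap A (σ.pow 0) f) (rMap A (σ.pow 0) g) ↔ Function.Exact f g :=
  (Function.Exact.iff_of_ladder_linearEquiv (e₁ := rid A X) (e₂ := rid A Y) (e₃ := rid A Z)
    (LinearMap.ext fun t => (rid_rMap f t).symm)
    (LinearMap.ext fun t => (rid_rMap g t).symm)).symm

/-- If all `N ⊗^L σ^n` are pure, then all `N ⊗ σ^n` are acyclic for `- ⊗ σ`. -/
theorem torVanish_of_isPure (hpure : ∀ n : ℕ, 1 ≤ n → IsPure (σ.derivedPow n))
    {N : ModuleCat.{u} Aᵐᵒᵖ} (h : ∀ n, IsPure (derivedTensorModule N (σ.pow n))) (n k : ℕ) :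
    TorVanish A σ k (BalTensor A N (σ.pow n)) := by
  obtain ⟨P, q, hq, hPp, hPj, hP⟩ :=
    exists_derivedTensor_eq (isAugmentation_single N) (isPure_single N)
  have h' : ∀ n, _ := fun n => (isPure_tensor_iff P (σ.pow n)).1 (hP (σ.pow n) ▸ h n)
  -- By purity at `n`, `P ⊗ σ^n` resolves `N ⊗ σ^n` by acyclic modules; by purity at `n + 1` it
  -- stays exact after a further `- ⊗ σ`.
  refine .of_resolution (P := fun i => ModuleCat.of Aᵐᵒᵖ (BalTensor A (P.X i) (σ.pow n)))
    (fun i => rMap A (σ.pow n) (P.d (i + 1) i).hom) (rMap A (σ.pow n) q)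
    (fun i k => torVanish_tensor_of_projective (torVanish_pow hpure k n) _) (h' n)
    (rMap_exact hq.exact hq.surj) (rMap_surjective hq.surj) fun i => ?_
  exact (exact_rMap_pow_succ_iff _ _ n).1 (h' (n + 1) i)

/-- If all `N ⊗ σ^n` are acyclic for `- ⊗ σ`, then all `N ⊗^L σ^n` are pure. -/
theorem isPure_of_torVanish (hpure : ∀ n : ℕ, 1 ≤ n → IsPure (σ.derivedPow n))
    {N : ModuleCat.{u} Aᵐᵒᵖ} (h : ∀ n k, TorVanish A σ k (BalTensor A N (σ.pow n))) (n : ℕ) :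
    IsPure (derivedTensorModule N (σ.pow n)) := by
  obtain ⟨P, q, hq, hPp, hPj, hP⟩ :=
    exists_derivedTensor_eq (isAugmentation_single N) (isPure_single N)
  have h' : derivedTensorModule N (σ.pow n) = _ := hP (σ.pow n)
  rw [h', isPure_tensor_iff]
  clear h'
  induction n with
  | zero => exact fun i => (exact_rMap_pow_zero_iff _ _).2 ((isPure_iff P).1 hPp i)
  | succ n ih =>
    refine fun i => (exact_rMap_pow_succ_iff _ _ n).2 ?_
    exact exact_rMap_of_torVanish i
      (P := fun i => ModuleCat.of Aᵐᵒᵖ (BalTensor A (P.X i) (σ.pow n)))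
      (fun i => rMap A (σ.pow n) (P.d (i + 1) i).hom) (rMap A (σ.pow n) q)
      (fun i k => torVanish_tensor_of_projective (torVanish_pow hpure k n) _) ih
      (rMap_exact hq.exact hq.surj) (rMap_surjective hq.surj) (h n)

end RingBimod

/-! ### Coherence and finite presentation over `A`. -/

namespace RingBimod

open BalTensor

variable {A : Type u} [Ring A]

instance : Module.Finite Aᵐᵒᵖ A := .equiv (opEquiv A)

instance (k : ℕ) : Module.Projective Aᵐᵒᵖ (Fin k → A) :=
  .of_equiv (LinearEquiv.piCongrRight (R := Aᵐᵒᵖ) fun _ : Fin k => opEquiv A)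

theorem exists_pi_surjective (M : Type u) [AddCommGroup M] [Module Aᵐᵒᵖ M]
    [Module.Finite Aᵐᵒᵖ M] :
    ∃ (k : ℕ) (g : (Fin k → A) →ₗ[Aᵐᵒᵖ] M), Function.Surjective g := by
  obtain ⟨k, g, hg⟩ := Module.Finite.exists_fin' Aᵐᵒᵖ M
  let e := LinearEquiv.piCongrRight (R := Aᵐᵒᵖ) fun _ : Fin k => (opEquiv A).symm
  exact ⟨k, g ∘ₗ e.toLinearMap, hg.comp e.surjective⟩

theorem exists_pi_range_eq {M : Type u} [AddCommGroup M] [Module Aᵐᵒᵖ M]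
    {K : Submodule Aᵐᵒᵖ M} (hK : K.FG) :
    ∃ (k : ℕ) (g : (Fin k → A) →ₗ[Aᵐᵒᵖ] M), LinearMap.range g = K := by
  have := Module.Finite.iff_fg.2 hK
  obtain ⟨k, g, hg⟩ := exists_pi_surjective (A := A) K
  refine ⟨k, K.subtype ∘ₗ g, ?_⟩
  rw [LinearMap.range_comp_of_range_eq_top _ (LinearMap.range_eq_top.2 hg), K.range_subtype]

theorem ker_fg_of_surjective {R L M N : Type*} [Ring R] [AddCommGroup L] [Module R L]
    [AddCommGroup M] [Module R M] [AddCommGroup N] [Module R N] {g : L →ₗ[R] M}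
    (hg : Function.Surjective g) {f : M →ₗ[R] N} (h : (LinearMap.ker (f ∘ₗ g)).FG) :
    (LinearMap.ker f).FG := by
  have : LinearMap.ker f = (LinearMap.ker (f ∘ₗ g)).map g := by
    rw [LinearMap.ker_comp, Submodule.map_comap_eq_of_surjective hg]
  rw [this]
  exact h.map g

/-- The definition of coherence treats one coordinate. Cover the kernel of the remaining coordinates
by a finite free module and apply the definition to coordinate 0 restricted to that cover. -/
theorem _root_.IsRightCoherent.ker_fg_pi (hA : IsRightCoherent A) (l : ℕ) :
    ∀ {L : Type u} [AddCommGroup L] [Module Aᵐᵒᵖ L] [Module.Finite Aᵐᵒᵖ L]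
      (f : L →ₗ[Aᵐᵒᵖ] (Fin l → A)), (LinearMap.ker f).FG := by
  induction l with
  | zero =>
    intro L _ _ _ f
    have : LinearMap.ker f = ⊤ := LinearMap.ker_eq_top.2 (LinearMap.ext fun x =>
      Subsingleton.elim _ _)
    rw [this]
    exact Module.Finite.fg_top
  | succ l ih =>
    intro L _ _ _ f
    obtain ⟨m, g, hg⟩ := exists_pi_range_eq (ih (LinearMap.funLeft Aᵐᵒᵖ A Fin.succ ∘ₗ f))
    have h0 := hA.2 m (LinearMap.proj 0 ∘ₗ f ∘ₗ g)
    have : LinearMap.ker f = (LinearMap.ker (LinearMap.proj 0 ∘ₗ f ∘ₗ g)).map g := by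
      ext x
      constructor
      · intro hx
        have hx' : f x = 0 := hx
        have : x ∈ LinearMap.range g := by
          rw [hg, LinearMap.mem_ker, LinearMap.comp_apply, hx', map_zero]
        obtain ⟨y, rfl⟩ := this
        exact ⟨y, congrFun hx' 0, rfl⟩
      · rintro ⟨y, hy, rfl⟩
        have h1 : g y ∈ LinearMap.ker (LinearMap.funLeft Aᵐᵒᵖ A Fin.succ ∘ₗ f) :=
          hg ▸ ⟨y, rfl⟩
        refine funext fun i => ?_
        cases i using Fin.cases with
        | zero => exact hy
        | succ i => exact congrFun h1 i
    rw [this]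
    exact h0.map g

/-- Over a right coherent ring, the kernel of a map from a finitely generated module to a finitely
presented one is finitely generated. -/
theorem _root_.IsRightCoherent.ker_fg (hA : IsRightCoherent A) {L N : Type u} [AddCommGroup L]
    [Module Aᵐᵒᵖ L] [Module.Finite Aᵐᵒᵖ L] [AddCommGroup N] [Module Aᵐᵒᵖ N]
    [Module.FinitePresentation Aᵐᵒᵖ N] (f : L →ₗ[Aᵐᵒᵖ] N) : (LinearMap.ker f).FG := by
  obtain ⟨l, q, hq⟩ := exists_pi_surjective (A := A) N
  obtain ⟨m, r, hr⟩ := exists_pi_range_eq (Module.FinitePresentation.fg_ker q hq)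
  obtain ⟨k, g, hg⟩ := exists_pi_surjective (A := A) L
  obtain ⟨φ, hφ⟩ := Module.projective_lifting_property q (f ∘ₗ g) hq
  refine ker_fg_of_surjective hg ?_
  have h := IsRightCoherent.ker_fg_pi hA l (φ.coprod r)
  -- `x` is killed in `N` exactly when `φ x` is a relation, that is, when `φ x + r y = 0` for some
  -- `y`.
  have : LinearMap.ker (f ∘ₗ g) =
      (LinearMap.ker (φ.coprod r)).map (LinearMap.fst Aᵐᵒᵖ _ _) := by
    rw [← hφ]
    ext x
    constructor
    · intro hx
      have : -φ x ∈ LinearMap.range r := by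
        rw [hr, LinearMap.mem_ker, map_neg, neg_eq_zero]
        exact hx
      obtain ⟨y, hy⟩ := this
      exact ⟨(x, y), by simp [hy], rfl⟩
    · rintro ⟨⟨x, y⟩, hxy, rfl⟩
      have hxy' : φ x + r y = 0 := hxy
      have hy : r y ∈ LinearMap.ker q := hr ▸ ⟨y, rfl⟩
      have := congrArg q hxy'
      rw [map_add, LinearMap.mem_ker.1 hy, add_zero, map_zero] at this
      exact this
  rw [this]
  exact h.map _

/-- The isomorphism `A^k ⊗ B ≅ B^k`. -/
noncomputable def piTensorEquiv (B : RingBimod A) (k : ℕ) :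
    BalTensor A (Fin k → A) B ≃ₗ[Aᵐᵒᵖ] (Fin k → B) :=
  let ι := ULift.{u} (Fin k)
  let e₁ : (⨁ _ : ι, A) ≃ₗ[Aᵐᵒᵖ] (Fin k → A) :=
    (DirectSum.linearEquivFunOnFintype Aᵐᵒᵖ ι fun _ => A).trans
      (LinearEquiv.piCongrLeft Aᵐᵒᵖ (fun _ => A) Equiv.ulift)
  let e₂ : (⨁ _ : ι, BalTensor A A B) ≃ₗ[Aᵐᵒᵖ] (Fin k → BalTensor A A B) :=
    (DirectSum.linearEquivFunOnFintype Aᵐᵒᵖ ι fun _ => BalTensor A A B).trans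
      (LinearEquiv.piCongrLeft Aᵐᵒᵖ (fun _ => BalTensor A A B) Equiv.ulift)
  (rCongr e₁.symm).trans <| (BalTensor.directSum B fun _ : ι => A).trans <| e₂.trans <|
    LinearEquiv.piCongrRight fun _ => lid A B

variable {B : RingBimod A}

theorem finite_tensor (hB : Module.Finite Aᵐᵒᵖ B) (M : Type u) [AddCommGroup M] [Module Aᵐᵒᵖ M]
    [Module.Finite Aᵐᵒᵖ M] : Module.Finite Aᵐᵒᵖ (BalTensor A M B) := by
  obtain ⟨k, g, hg⟩ := exists_pi_surjective (A := A) M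
  have : Module.Finite Aᵐᵒᵖ (BalTensor A (Fin k → A) B) := .equiv (piTensorEquiv B k).symm
  exact .of_surjective _ (rMap_surjective hg)

theorem finitePresentation_tensor (hB : Module.FinitePresentation Aᵐᵒᵖ B) (M : Type u)
    [AddCommGroup M] [Module Aᵐᵒᵖ M] [Module.FinitePresentation Aᵐᵒᵖ M] :
    Module.FinitePresentation Aᵐᵒᵖ (BalTensor A M B) := by
  obtain ⟨k, g, hg⟩ := exists_pi_surjective (A := A) M
  have hfp : Module.FinitePresentation Aᵐᵒᵖ (BalTensor A (Fin k → A) B) :=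
    .of_equiv (piTensorEquiv B k).symm
  refine Module.finitePresentation_of_surjective _ (rMap_surjective hg) ?_
  have he := (rMap_exact (N := B) (LinearMap.exact_subtype_ker_map g) hg).linearMap_ker_eq
  rw [he]
  have := Module.Finite.iff_fg.2 (Module.FinitePresentation.fg_ker g hg)
  have := finite_tensor (B := B) inferInstance (LinearMap.ker g)
  exact Module.Finite.iff_fg.1 (Module.Finite.range _)

theorem finitePresentation_regular : Module.FinitePresentation Aᵐᵒᵖ A :=
  .of_equiv (opEquiv A)

theorem finitePresentation_pow {σ : RingBimod A} (hσ : Module.FinitePresentation Aᵐᵒᵖ σ) :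
    ∀ n : ℕ, Module.FinitePresentation Aᵐᵒᵖ (σ.pow n)
  | 0 => finitePresentation_regular
  | n + 1 => by
    have := finitePresentation_pow hσ n
    exact finitePresentation_tensor hσ (σ.pow n)

end RingBimod

/-! ### Graded modules, graded projectivity and syzygies. -/

theorem DirectSum.isInternal_of_projections {X : Type*} [AddCommGroup X] {deg : ℤ → AddSubgroup X}
    (π : ℤ → X →+ X) (h_mem : ∀ i x, π i x ∈ deg i) (h_same : ∀ i x, x ∈ deg i → π i x = x)
    (h_ne : ∀ i j x, x ∈ deg j → j ≠ i → π i x = 0)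
    (h_sum : ∀ x, ∃ s : Finset ℤ, ∀ s', s ⊆ s' → ∑ i ∈ s', π i x = x) :
    DirectSum.IsInternal deg := by
  have key : ∀ i (t : ⨁ i, deg i), π i (DirectSum.coeAddMonoidHom deg t) = t i := by
    intro i t
    induction t using DirectSum.induction_on with
    | zero => simp
    | of j x =>
      rw [DirectSum.coeAddMonoidHom_of]
      by_cases hij : j = i
      · subst hij
        rw [h_same _ _ x.2, DirectSum.of_eq_same]
      · rw [h_ne i j x x.2 hij, DirectSum.of_eq_of_ne _ _ _ (Ne.symm hij), ZeroMemClass.coe_zero]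
    | add x y hx hy => rw [map_add, map_add, hx, hy, DirectSum.add_apply, AddSubgroup.coe_add]
  constructor
  · rw [injective_iff_map_eq_zero]
    intro t ht
    refine DFinsupp.ext fun i => Subtype.ext ?_
    have := key i t
    rw [ht, map_zero] at this
    exact this.symm
  · intro x
    obtain ⟨s, hs⟩ := h_sum x
    refine ⟨∑ i ∈ s, DirectSum.of (fun i => deg i) i ⟨π i x, h_mem i x⟩, ?_⟩
    rw [map_sum]
    simp only [DirectSum.coeAddMonoidHom_of]
    exact hs s subset_rfl

namespace GradedRightModule

variable {S : Type u} [Ring S] {𝒮 : ℤ → AddSubgroup S}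

/-- The projection of a graded module onto its component of degree `i`. -/
noncomputable def proj (M : GradedRightModule S 𝒮) (i : ℤ) : M →+ M :=
  (M.deg i).subtype.comp ((DFinsupp.evalAddMonoidHom i).comp
    (AddEquiv.ofBijective _ M.isInternal).symm.toAddMonoidHom)

variable (M N : GradedRightModule S 𝒮)

theorem proj_mem (i : ℤ) (x : M) : M.proj i x ∈ M.deg i := Subtype.prop _

theorem proj_coe (i : ℤ) (t : ⨁ i, M.deg i) :
    M.proj i (DirectSum.coeAddMonoidHom M.deg t) = t i :=
  congrArg (fun t : ⨁ i, M.deg i => (t i : M))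
    ((AddEquiv.ofBijective _ M.isInternal).symm_apply_apply t)

theorem proj_same {i : ℤ} {x : M} (hx : x ∈ M.deg i) : M.proj i x = x := by
  have h := M.proj_coe i (DirectSum.of (fun i => M.deg i) i ⟨x, hx⟩)
  rwa [DirectSum.coeAddMonoidHom_of, DirectSum.of_eq_same] at h

theorem proj_ne {i j : ℤ} {x : M} (hx : x ∈ M.deg j) (hij : j ≠ i) : M.proj i x = 0 := by
  have h := M.proj_coe i (DirectSum.of (fun i => M.deg i) j ⟨x, hx⟩)
  rwa [DirectSum.coeAddMonoidHom_of, DirectSum.of_eq_of_ne _ _ _ (Ne.symm hij)] at h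

theorem exists_sum_proj (x : M) : ∃ s : Finset ℤ, ∀ s', s ⊆ s' → ∑ i ∈ s', M.proj i x = x := by
  classical
  obtain ⟨t, rfl⟩ := M.isInternal.2 x
  refine ⟨DFinsupp.support t, fun s' hs' => ?_⟩
  simp only [proj_coe]
  conv_rhs => rw [← DirectSum.sum_support_of t, map_sum]
  simp only [DirectSum.coeAddMonoidHom_of]
  refine (Finset.sum_subset hs' fun i _ hi => ?_).symm
  rw [DFinsupp.notMem_support_iff.1 hi, ZeroMemClass.coe_zero]

/-- Scalars of degree 0 preserve every component. Over the tensor algebra this makes the projections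
`A`-linear. -/
theorem proj_smul (i : ℤ) {s : S} (hs : s ∈ 𝒮 0) (x : M) :
    M.proj i (op s • x) = op s • M.proj i x := by
  obtain ⟨t, ht⟩ := M.exists_sum_proj x
  have h := ht (insert i t) (Finset.subset_insert _ _)
  have hj : ∀ j, op s • M.proj j x ∈ M.deg j := fun j => by
    have := M.smul_mem j 0 _ s (M.proj_mem j x) hs
    rwa [add_zero] at this
  conv_lhs => rw [← h, Finset.smul_sum, map_sum]
  rw [Finset.sum_eq_single i (fun j _ hji => M.proj_ne (hj j) hji)
    (fun hi => (hi (Finset.mem_insert_self _ _)).elim), M.proj_same (hj i)]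

variable {M N} in
theorem IsGradedHom.map_proj {f : M →ₗ[Sᵐᵒᵖ] N} (hf : IsGradedHom f) (i : ℤ) (x : M) :
    f (M.proj i x) = N.proj i (f x) := by
  obtain ⟨s, hs⟩ := M.exists_sum_proj x
  have h := hs (insert i s) (Finset.subset_insert _ _)
  conv_rhs => rw [← h, map_sum, map_sum]
  rw [Finset.sum_eq_single i (fun j _ hj => N.proj_ne (hf j _ (M.proj_mem j x)) hj)
    (fun hi => (hi (Finset.mem_insert_self _ _)).elim), N.proj_same (hf i _ (M.proj_mem i x))]

variable {M N} in
theorem IsGradedHom.mem_deg_of_injective {f : M →ₗ[Sᵐᵒᵖ] N} (hf : IsGradedHom f)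
    (hi : Function.Injective f) {i : ℤ} {x : M} (hx : f x ∈ N.deg i) : x ∈ M.deg i := by
  have : M.proj i x = x := hi (by rw [hf.map_proj, N.proj_same hx])
  rw [← this]
  exact M.proj_mem i x

variable {M N} in
theorem IsGradedHom.comp {L : GradedRightModule S 𝒮} {g : N →ₗ[Sᵐᵒᵖ] L} (hg : IsGradedHom g)
    {f : M →ₗ[Sᵐᵒᵖ] N} (hf : IsGradedHom f) : IsGradedHom (M := M) (N := L) (g ∘ₗ f) :=
  fun i _ hx => hg i _ (hf i _ hx)

variable {M N} in
theorem IsGradedHom.exists_corestrict {L : GradedRightModule S 𝒮} {g : N →ₗ[Sᵐᵒᵖ] L}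
    (hg : IsGradedHom g) (hi : Function.Injective g) {f : M →ₗ[Sᵐᵒᵖ] L} (hf : IsGradedHom f)
    (hfg : ∀ x, f x ∈ LinearMap.range g) :
    ∃ h : M →ₗ[Sᵐᵒᵖ] N, IsGradedHom h ∧ ∀ x, g (h x) = f x := by
  let e := LinearEquiv.ofInjective g hi
  let h : M →ₗ[Sᵐᵒᵖ] N := e.symm.toLinearMap ∘ₗ LinearMap.codRestrict (LinearMap.range g) f hfg
  have hh : ∀ x, g (h x) = f x := fun x =>
    congrArg Subtype.val (e.apply_symm_apply ⟨f x, hfg x⟩)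
  refine ⟨h, fun i x hx => hg.mem_deg_of_injective hi ?_, hh⟩
  rw [hh]
  exact hf i x hx

/-- The graded module structure on a homogeneous submodule. -/
noncomputable def ofSubmodule (M : GradedRightModule S 𝒮) (K : Submodule Sᵐᵒᵖ M)
    (hK : ∀ i, ∀ x ∈ K, M.proj i x ∈ K) : GradedRightModule S 𝒮 where
  carrier := K
  deg i := (M.deg i).comap K.subtype.toAddMonoidHom
  isInternal := DirectSum.isInternal_of_projections
    (fun i => ((M.proj i).comp K.subtype.toAddMonoidHom).codRestrict K fun x => hK i x x.2)
    (fun i x => M.proj_mem i x)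
    (fun i x hx => Subtype.ext (M.proj_same hx))
    (fun i j x hx hij => Subtype.ext (M.proj_ne hx hij))
    (fun x => by
      obtain ⟨s, hs⟩ := M.exists_sum_proj x
      refine ⟨s, fun s' hs' => Subtype.ext ?_⟩
      rw [AddSubmonoidClass.coe_finsetSum]
      exact hs s' hs')
  smul_mem i j x s hx hs := M.smul_mem i j x s hx hs

/-- The direct sum of two graded modules. -/
noncomputable def prod : GradedRightModule S 𝒮 where
  carrier := M × N
  deg i := (M.deg i).prod (N.deg i)
  isInternal := DirectSum.isInternal_of_projections
    (fun i => (M.proj i).prodMap (N.proj i))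
    (fun i x => ⟨M.proj_mem i _, N.proj_mem i _⟩)
    (fun i x hx => Prod.ext (M.proj_same hx.1) (N.proj_same hx.2))
    (fun i j x hx hij => Prod.ext (M.proj_ne hx.1 hij) (N.proj_ne hx.2 hij))
    (fun x => by
      classical
      obtain ⟨s, hs⟩ := M.exists_sum_proj x.1
      obtain ⟨t, ht⟩ := N.exists_sum_proj x.2
      refine ⟨s ∪ t, fun s' hs' => Prod.ext ?_ ?_⟩
      · rw [Prod.fst_sum]
        exact hs s' (Finset.union_subset_left hs')
      · rw [Prod.snd_sum]
        exact ht s' (Finset.union_subset_right hs'))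
  smul_mem i j x s hx hs := ⟨M.smul_mem i j _ s hx.1 hs, N.smul_mem i j _ s hx.2 hs⟩

variable {M N}

theorem IsGradedProjective.prod (hM : IsGradedProjective M) (hN : IsGradedProjective N) :
    IsGradedProjective (M.prod N) := by
  intro X Y g f hg hs hf
  let f' : M × N →ₗ[Sᵐᵒᵖ] Y := f
  obtain ⟨a, ha, hga⟩ := hM X Y g (f' ∘ₗ LinearMap.inl _ _ _) hg hs
    (fun i x hx => hf i _ ⟨hx, zero_mem _⟩)
  obtain ⟨b, hb, hgb⟩ := hN X Y g (f' ∘ₗ LinearMap.inr _ _ _) hg hs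
    (fun i x hx => hf i _ ⟨zero_mem _, hx⟩)
  refine ⟨a.coprod b, fun i x hx => add_mem (ha i _ hx.1) (hb i _ hx.2), ?_⟩
  have : g ∘ₗ (a.coprod b) = f' := by
    rw [LinearMap.comp_coprod, hga, hgb]
    exact LinearMap.coprod_comp_inl_inr f'
  exact this

theorem ProjDimLE.prod : ∀ {n : ℕ} {M N : GradedRightModule S 𝒮}, ProjDimLE n M →
    IsGradedProjective N → ProjDimLE n (M.prod N)
  | 0, _, _, hM, hN => IsGradedProjective.prod hM hN
  | n + 1, M, N, ⟨K, P, i, p, hP, hi, hp, hinj, hex, hsurj, hK⟩, hN => by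
    refine ⟨K, P.prod N, (LinearMap.inl Sᵐᵒᵖ P N ∘ₗ i : K →ₗ[Sᵐᵒᵖ] P × N),
      (p.prodMap LinearMap.id : P × N →ₗ[Sᵐᵒᵖ] M × N), hP.prod hN,
      fun j x hx => ⟨hi j x hx, zero_mem _⟩, fun j x hx => ⟨hp j _ hx.1, hx.2⟩,
      LinearMap.inl_injective.comp hinj, ?_, ?_, hK⟩
    · rintro ⟨x, y⟩
      constructor
      · intro h
        obtain ⟨z, rfl⟩ := (hex x).1 (congrArg Prod.fst h)
        obtain rfl : y = 0 := congrArg Prod.snd h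
        exact ⟨z, rfl⟩
      · rintro ⟨z, hz⟩
        rw [← hz]
        exact Prod.ext (hex.apply_apply_eq_zero z) rfl
    · rintro ⟨x, y⟩
      obtain ⟨z, rfl⟩ := hsurj x
      exact ⟨(z, y), rfl⟩

/-- `M` is a direct summand of `N` as a graded module. -/
def IsGradedRetract (M N : GradedRightModule S 𝒮) : Prop :=
  ∃ (i : M →ₗ[Sᵐᵒᵖ] N) (r : N →ₗ[Sᵐᵒᵖ] M), IsGradedHom i ∧ IsGradedHom r ∧ ∀ x, r (i x) = x

theorem IsGradedRetract.refl (M : GradedRightModule S 𝒮) : IsGradedRetract M M :=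
  ⟨LinearMap.id, LinearMap.id, fun _ _ h => h, fun _ _ h => h, fun _ => rfl⟩

theorem IsGradedRetract.projective (h : IsGradedRetract M N) (hN : IsGradedProjective N) :
    IsGradedProjective M := by
  obtain ⟨i, r, hi, hr, hir⟩ := h
  intro X Y g f hg hs hf
  obtain ⟨a, ha, hga⟩ := hN X Y g (f ∘ₗ r) hg hs (hf.comp hr)
  refine ⟨a ∘ₗ i, ha.comp hi, LinearMap.ext fun x => ?_⟩
  have := DFunLike.congr_fun hga (i x)
  rw [LinearMap.comp_apply, LinearMap.comp_apply, hir] at this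
  exact this

/-- Syzygies of a summand of a module of projective dimension at most `n + 1` are summands of
modules of projective dimension at most `n`. -/
theorem IsGradedRetract.syzygy {n : ℕ} (h : IsGradedRetract M N) (hN : ProjDimLE (n + 1) N)
    {Z Q : GradedRightModule S 𝒮} (hQ : IsGradedProjective Q) {i : Z →ₗ[Sᵐᵒᵖ] Q}
    {q : Q →ₗ[Sᵐᵒᵖ] M} (hi : IsGradedHom i) (hq : IsGradedHom q) (hinj : Function.Injective i)
    (hex : Function.Exact i q) (hsurj : Function.Surjective q) :
    ∃ N' : GradedRightModule S 𝒮, ProjDimLE n N' ∧ IsGradedRetract Z N' := by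
  obtain ⟨α, β, hα, hβ, hαβ⟩ := h
  obtain ⟨K, P, j, p, hP, hj, hp, hjinj, hjex, hpsurj, hK⟩ := hN
  obtain ⟨a, ha, hpa⟩ := hQ P N p (α ∘ₗ q) hp hpsurj (hα.comp hq)
  obtain ⟨b, hb, hqb⟩ := hP Q M q (β ∘ₗ p) hq hsurj (hβ.comp hp)
  have hpa' : ∀ x, p (a x) = α (q x) := DFunLike.congr_fun hpa
  have hqb' : ∀ x, q (b x) = β (p x) := DFunLike.congr_fun hqb
  obtain ⟨α', hα', hjα⟩ := hj.exists_corestrict (M := Z) hjinj (ha.comp hi) fun x =>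
    (hjex _).1 (by rw [LinearMap.comp_apply, hpa', hex.apply_apply_eq_zero, map_zero])
  obtain ⟨β', hβ', hiβ⟩ := hi.exists_corestrict (M := K) hinj (hb.comp hj) fun x =>
    (hex _).1 (by rw [LinearMap.comp_apply, hqb', hjex.apply_apply_eq_zero, map_zero])
  -- A weak form of Schanuel's lemma: `b ∘ a` lifts the identity of `M` but need not be the identity
  -- of `Q`. The difference lands in `Z`, and `γ` records it, so that `β' α' + γ i` is the identity
  -- of `Z`.
  obtain ⟨γ, hγ, hiγ⟩ := hi.exists_corestrict (M := Q) (f := LinearMap.id - b ∘ₗ a) hinj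
    (fun i x hx => sub_mem hx (hb i _ (ha i _ hx))) fun x => (hex _).1 (by
      rw [LinearMap.sub_apply, map_sub, LinearMap.comp_apply, hqb', hpa', hαβ,
        LinearMap.id_apply, sub_self])
  refine ⟨K.prod Q, hK.prod hQ, (α'.prod i : Z →ₗ[Sᵐᵒᵖ] K × Q),
    (β'.coprod γ : K × Q →ₗ[Sᵐᵒᵖ] Z), fun l x hx => ⟨hα' l x hx, hi l x hx⟩,
    fun l x hx => add_mem (hβ' l _ hx.1) (hγ l _ hx.2), fun x => hinj ?_⟩
  change i (β' (α' x) + γ (i x)) = i x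
  rw [map_add, hiβ, hiγ, LinearMap.comp_apply, hjα, LinearMap.sub_apply, LinearMap.comp_apply,
    LinearMap.comp_apply, LinearMap.id_apply, add_sub_cancel]

/-- Each of the finitely many generators is replaced by its finitely many components, which lie in
`K` by homogeneity. -/
theorem exists_homogeneous_generators {K : Submodule Sᵐᵒᵖ M} (hK : ∀ i, ∀ x ∈ K, M.proj i x ∈ K)
    (hfg : K.FG) : ∃ (k : ℕ) (d : Fin k → ℤ) (x : Fin k → M), (∀ j, x j ∈ M.deg (d j)) ∧
      Submodule.span Sᵐᵒᵖ (Set.range x) = K := by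
  classical
  obtain ⟨G, rfl⟩ := hfg
  choose s hs using M.exists_sum_proj
  let H : Finset (ℤ × M) := G.biUnion fun g => (s g).image fun i => (i, M.proj i g)
  have hH : ∀ y ∈ H, y.2 ∈ M.deg y.1 ∧ y.2 ∈ Submodule.span Sᵐᵒᵖ (G : Set M) := by
    intro y hy
    obtain ⟨g, hg, hy⟩ := Finset.mem_biUnion.1 hy
    obtain ⟨i, hi, rfl⟩ := Finset.mem_image.1 hy
    exact ⟨M.proj_mem _ _, hK i g (Submodule.subset_span hg)⟩
  let e := H.equivFin.symm
  refine ⟨H.card, fun j => (e j).1.1, fun j => (e j).1.2, fun j => (hH _ (e j).2).1,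
    le_antisymm ?_ ?_⟩
  · rw [Submodule.span_le]
    rintro _ ⟨j, rfl⟩
    exact (hH _ (e j).2).2
  · rw [Submodule.span_le]
    intro g hg
    rw [← hs g (s g) subset_rfl]
    refine sum_mem fun i hi => Submodule.subset_span ?_
    have hy : (i, M.proj i g) ∈ H :=
      Finset.mem_biUnion.2 ⟨g, hg, Finset.mem_image_of_mem _ hi⟩
    refine ⟨e.symm ⟨_, hy⟩, ?_⟩
    simp

theorem IsGradedHom.ker_homogeneous {f : M →ₗ[Sᵐᵒᵖ] N} (hf : IsGradedHom f) (i : ℤ) (x : M)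
    (hx : x ∈ LinearMap.ker f) : M.proj i x ∈ LinearMap.ker f := by
  rw [LinearMap.mem_ker, hf.map_proj, LinearMap.mem_ker.1 hx, map_zero]

theorem IsGradedHom.range_homogeneous {f : M →ₗ[Sᵐᵒᵖ] N} (hf : IsGradedHom f) (i : ℤ) (x : N)
    (hx : x ∈ LinearMap.range f) : N.proj i x ∈ LinearMap.range f := by
  obtain ⟨y, rfl⟩ := hx
  exact ⟨M.proj i y, hf.map_proj i y⟩

/-! ### Finitely generated graded free modules -/

variable {k : ℕ}

theorem mem_freeDeg {d : Fin k → ℤ} {i : ℤ} {v : Fin k → S} :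
    v ∈ freeDeg 𝒮 d i ↔ ∀ j, v j ∈ 𝒮 (i - d j) := by
  simp [freeDeg, AddSubgroup.mem_pi]

variable [GradedRing 𝒮]

variable (𝒮) in
/-- The graded free module `S(-d 1) ⊕ ⋯ ⊕ S(-d k)`. -/
noncomputable abbrev free (d : Fin k → ℤ) : GradedRightModule S 𝒮 where
  carrier := Fin k → S
  deg := freeDeg 𝒮 d
  isInternal := DirectSum.isInternal_of_projections
    (fun i => AddMonoidHom.pi fun j =>
      ((regular 𝒮).proj (i - d j)).comp (Pi.evalAddMonoidHom (fun _ => S) j))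
    (fun i x => mem_freeDeg.2 fun j => (regular 𝒮).proj_mem _ _)
    (fun i x hx => funext fun j => (regular 𝒮).proj_same (mem_freeDeg.1 hx j))
    (fun i l x hx hil => funext fun j =>
      (regular 𝒮).proj_ne (mem_freeDeg.1 hx j) fun h => hil (sub_left_injective h))
    (fun x => by
      classical
      choose s hs using fun j => (regular 𝒮).exists_sum_proj (x j)
      refine ⟨Finset.univ.biUnion fun j => (s j).image (· + d j), fun s' hs' => funext fun j => ?_⟩
      rw [Finset.sum_apply]
      have h := hs j (s'.image (· - d j)) fun i hi => Finset.mem_image.2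
        ⟨i + d j, hs' (Finset.mem_biUnion.2 ⟨j, Finset.mem_univ _,
          Finset.mem_image_of_mem _ hi⟩), add_sub_cancel_right _ _⟩
      rw [Finset.sum_image fun a _ b _ hab => sub_left_injective hab] at h
      exact h)
  smul_mem i j x s hx hs := mem_freeDeg.2 fun l => by
    have := SetLike.mul_mem_graded (mem_freeDeg.1 hx l) hs
    rwa [show i - d l + j = i + j - d l by ring] at this

theorem single_mem_freeDeg (d : Fin k → ℤ) (j : Fin k) :
    (Pi.single j 1 : Fin k → S) ∈ freeDeg 𝒮 d (d j) := by
  refine mem_freeDeg.2 fun l => ?_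
  by_cases h : l = j
  · subst h
    rw [Pi.single_eq_same, sub_self]
    exact SetLike.GradedOne.one_mem
  · rw [Pi.single_eq_of_ne h]
    exact zero_mem _

section FreeLift

variable {X : Type*} [AddCommGroup X] [Module Sᵐᵒᵖ X]

/-- The homomorphism from a free module with prescribed values on the basis. -/
def freeLift (x : Fin k → X) : (Fin k → S) →ₗ[Sᵐᵒᵖ] X where
  toFun v := ∑ j, op (v j) • x j
  map_add' v w := by
    rw [← Finset.sum_add_distrib]
    exact Finset.sum_congr rfl fun j _ => by rw [Pi.add_apply, MulOpposite.op_add, add_smul]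
  map_smul' s v := by
    rw [RingHom.id_apply, Finset.smul_sum]
    exact Finset.sum_congr rfl fun j _ => by rw [smul_smul]; rfl

theorem freeLift_single (x : Fin k → X) (j : Fin k) :
    freeLift x (Pi.single j (1 : S)) = x j := by
  change ∑ l, op ((Pi.single j (1 : S) : Fin k → S) l) • x l = x j
  rw [Finset.sum_eq_single j (fun l _ hl => by rw [Pi.single_eq_of_ne hl, MulOpposite.op_zero,
    zero_smul]) (fun h => (h (Finset.mem_univ _)).elim), Pi.single_eq_same, MulOpposite.op_one,
    one_smul]

theorem freeLift_ext {f g : (Fin k → S) →ₗ[Sᵐᵒᵖ] X}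
    (h : ∀ j, f (Pi.single j 1) = g (Pi.single j 1)) : f = g := by
  have key : ∀ v : Fin k → S, v = ∑ j, op (v j) • (Pi.single j (1 : S) : Fin k → S) := by
    intro v
    funext l
    rw [Finset.sum_apply, Finset.sum_eq_single l (fun j _ hj => by
      rw [Pi.smul_apply, Pi.single_eq_of_ne (Ne.symm hj), smul_zero])
      (fun h => (h (Finset.mem_univ _)).elim), Pi.smul_apply, Pi.single_eq_same]
    exact (one_mul _).symm
  refine LinearMap.ext fun v => ?_
  rw [key v, map_sum, map_sum]
  exact Finset.sum_congr rfl fun j _ => by rw [map_smul, map_smul, h]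

theorem range_freeLift (x : Fin k → X) :
    LinearMap.range (freeLift (S := S) x) = Submodule.span Sᵐᵒᵖ (Set.range x) := by
  apply le_antisymm
  · rintro _ ⟨v, rfl⟩
    change ∑ j, op (v j) • x j ∈ _
    exact Submodule.sum_mem _ fun j _ =>
      Submodule.smul_mem _ _ (Submodule.subset_span (Set.mem_range_self j))
  · rw [Submodule.span_le]
    rintro _ ⟨j, rfl⟩
    exact LinearMap.mem_range.2 ⟨_, freeLift_single x j⟩

end FreeLift

theorem isGradedHom_freeLift {d : Fin k → ℤ} {x : Fin k → M} (hx : ∀ j, x j ∈ M.deg (d j)) :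
    IsGradedHom (M := free 𝒮 d) (N := M) (freeLift x) := by
  intro i v hv
  change ∑ j, op (v j) • x j ∈ M.deg i
  refine sum_mem fun j _ => ?_
  have := M.smul_mem (d j) (i - d j) (x j) (v j) (hx j) (mem_freeDeg.1 hv j)
  rwa [add_sub_cancel] at this

theorem isGradedProjective_free (d : Fin k → ℤ) : IsGradedProjective (free 𝒮 d) := by
  intro X Y g f hg hs hf
  have : ∀ j, ∃ x ∈ X.deg (d j), g x = f (Pi.single j 1 : Fin k → S) := by
    intro j
    obtain ⟨x, hx⟩ := hs (f (Pi.single j 1 : Fin k → S))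
    refine ⟨X.proj (d j) x, X.proj_mem _ _, ?_⟩
    rw [hg.map_proj, hx]
    exact Y.proj_same (hf _ _ (single_mem_freeDeg d j))
  choose x hx hgx using this
  refine ⟨freeLift x, isGradedHom_freeLift hx, freeLift_ext fun j => ?_⟩
  rw [LinearMap.comp_apply, freeLift_single, hgx]

theorem exists_free_range_eq {K : Submodule Sᵐᵒᵖ M} (hK : ∀ i, ∀ x ∈ K, M.proj i x ∈ K)
    (hfg : K.FG) : ∃ (k : ℕ) (d : Fin k → ℤ) (f : (Fin k → S) →ₗ[Sᵐᵒᵖ] M),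
      IsGradedHom (M := free 𝒮 d) (N := M) f ∧ LinearMap.range f = K := by
  obtain ⟨k, d, x, hx, hspan⟩ := exists_homogeneous_generators hK hfg
  exact ⟨k, d, freeLift x, isGradedHom_freeLift hx, (range_freeLift x).trans hspan⟩

/-- Graded coherence speaks of maps into `S` only. As over `A`, induction on the rank of the target
reduces to one coordinate at a time. -/
theorem _root_.IsGradedRightCoherent.ker_fg (hS : IsGradedRightCoherent 𝒮) (l : ℕ) :
    ∀ (e : Fin l → ℤ) {k : ℕ} (d : Fin k → ℤ) (f : (Fin k → S) →ₗ[Sᵐᵒᵖ] (Fin l → S)),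
      IsGradedHom (M := free 𝒮 d) (N := free 𝒮 e) f → (LinearMap.ker f).FG := by
  induction l with
  | zero =>
    intro e k d f _
    have : LinearMap.ker f = LinearMap.range (freeLift (S := S)
        (fun j : Fin k => (Pi.single j 1 : Fin k → S))) := by
      rw [LinearMap.ker_eq_top.2 (LinearMap.ext fun x => Subsingleton.elim _ _)]
      have : freeLift (S := S) (fun j : Fin k => (Pi.single j 1 : Fin k → S)) = LinearMap.id :=
        freeLift_ext fun j => freeLift_single _ j
      rw [this, LinearMap.range_id]
    rw [this, range_freeLift]
    exact Submodule.fg_span (Set.finite_range _)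
  | succ l ih =>
    intro e k d f hf
    have ht : IsGradedHom (M := free 𝒮 d) (N := free 𝒮 (e ∘ Fin.succ))
        (LinearMap.funLeft Sᵐᵒᵖ S Fin.succ ∘ₗ f) := fun i v hv =>
      mem_freeDeg.2 fun j => mem_freeDeg.1 (hf i v hv) j.succ
    obtain ⟨m, c, g, hg, hgr⟩ := exists_free_range_eq (M := free 𝒮 d) ht.ker_homogeneous
      (ih _ d _ ht)
    -- Coordinate 0 takes values in `S(-e 0)`; shifting the source degrees by `e 0` makes the target
    -- the unshifted `S`.
    have h0 := hS.2 m (fun j => c j - e 0) (LinearMap.proj 0 ∘ₗ f ∘ₗ g) (fun i v hv => by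
      have hv' : v ∈ freeDeg 𝒮 c (i + e 0) := mem_freeDeg.2 fun j => by
        have := mem_freeDeg.1 hv j
        rwa [show i - (c j - e 0) = i + e 0 - c j by ring] at this
      have := mem_freeDeg.1 (hf _ _ (hg _ v hv')) 0
      rwa [add_sub_cancel_right] at this)
    have : LinearMap.ker f = (LinearMap.ker (LinearMap.proj 0 ∘ₗ f ∘ₗ g)).map g := by
      ext x
      constructor
      · intro hx
        have hx' : f x = 0 := hx
        have : x ∈ LinearMap.range g := by
          rw [hgr, LinearMap.mem_ker, LinearMap.comp_apply, hx', map_zero]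
        obtain ⟨y, rfl⟩ := this
        exact ⟨y, congrFun hx' 0, rfl⟩
      · rintro ⟨y, hy, rfl⟩
        have h1 : g y ∈ LinearMap.ker (LinearMap.funLeft Sᵐᵒᵖ S Fin.succ ∘ₗ f) :=
          hgr ▸ ⟨y, rfl⟩
        refine funext fun i => ?_
        cases i using Fin.cases with
        | zero => exact hy
        | succ i => exact congrFun h1 i
    rw [this]
    exact h0.map g

end GradedRightModule

/-! ### The tensor algebra as a right `A`-module and multiplication by `σ`. -/

namespace RingBimod

open BalTensor GradedRightModule

variable {A : Type u} [Ring A] (σ : RingBimod A)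

/-- The inclusion of `σ^{⊗ n}` into the tensor algebra. -/
abbrev incl (n : ℕ) : σ.pow n →ₗ[Aᵐᵒᵖ] TensorAlg σ :=
  DirectSum.lof Aᵐᵒᵖ ℕ (fun n => (σ.pow n : Type u)) n

/-- An element of `A` as an element of `σ^{⊗ 0}`. -/
def scalarPow (a : A) : σ.pow 0 := a

/-- The inclusion of `A` into the tensor algebra. -/
abbrev scalar (a : A) : TensorAlg σ := incl σ 0 (scalarPow σ a)

/-- The inclusion of `σ` into the tensor algebra. -/
abbrev gen (s : σ) : TensorAlg σ := incl σ 1 (tmul σ 0 (powOne σ) s)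

theorem incl_mul_scalar (n : ℕ) (x : σ.pow n) (a : A) :
    incl σ n x * scalar σ a = incl σ n (op a • x) :=
  DirectSum.of_mul_of (A := fun n => (σ.pow n : Type u)) x (scalarPow σ a)

theorem incl_mul_gen (n : ℕ) (x : σ.pow n) (s : σ) :
    incl σ n x * gen σ s = incl σ (n + 1) (tmul σ n x s) := by
  have h : incl σ n x * gen σ s = incl σ (n + 1) (tmul σ n (op (1 : A) • x) s) :=
    DirectSum.of_mul_of (A := fun n => (σ.pow n : Type u)) x (tmul σ 0 (powOne σ) s)
  rw [h, MulOpposite.op_one, one_smul]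

theorem scalar_mul_gen (a : A) (s : σ) : scalar σ a * gen σ s = gen σ (a • s) := by
  rw [scalar, incl_mul_gen]
  refine congrArg (incl σ 1) ?_
  refine Eq.trans ?_ (mk_smul A (powOne σ) a s)
  exact congrArg (fun x => tmul σ 0 x s) (one_mul a).symm

theorem gen_add (s s' : σ) : gen σ (s + s') = gen σ s + gen σ s' := by
  rw [← map_add]
  exact congrArg (incl σ 1) (map_add (BalTensor.mk A (powOne σ)) s s')

/-- The right `A`-action on a right module over the tensor algebra is the restricted one. -/
class IsRestricted (X : Type*) [AddCommGroup X] [Module Aᵐᵒᵖ X] [Module (TensorAlg σ)ᵐᵒᵖ X] :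
    Prop where
  smul_eq : ∀ (a : A) (x : X), op a • x = op (scalar σ a) • x

instance : IsRestricted σ (TensorAlg σ) where
  smul_eq a x := by
    change op a • x = x * scalar σ a
    induction x using DirectSum.induction_on with
    | zero => rw [smul_zero, zero_mul]
    | of n x =>
      rw [← DirectSum.lof_eq_of Aᵐᵒᵖ, ← map_smul]
      exact (incl_mul_scalar σ n x a).symm
    | add x y hx hy => rw [smul_add, hx, hy, add_mul]

instance (k : ℕ) : IsRestricted σ (Fin k → TensorAlg σ) where
  smul_eq a x := funext fun j => IsRestricted.smul_eq (σ := σ) a (x j)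

section Action

variable {X Y : Type u} [AddCommGroup X] [Module Aᵐᵒᵖ X] [Module (TensorAlg σ)ᵐᵒᵖ X]
  [IsRestricted σ X] [AddCommGroup Y] [Module Aᵐᵒᵖ Y] [Module (TensorAlg σ)ᵐᵒᵖ Y]
  [IsRestricted σ Y]

variable {σ} in
/-- Restriction of scalars of a homomorphism from the tensor algebra to `A`. -/
def restrictHom (f : X →ₗ[(TensorAlg σ)ᵐᵒᵖ] Y) : X →ₗ[Aᵐᵒᵖ] Y where
  toFun := f
  map_add' := map_add f
  map_smul' b x := by
    rw [RingHom.id_apply, ← MulOpposite.op_unop b, IsRestricted.smul_eq (σ := σ),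
      IsRestricted.smul_eq (σ := σ), map_smul]

variable (X) in
/-- The action `X ⊗_A σ → X` on a right module over the tensor algebra. -/
def act : BalTensor A X σ →ₗ[Aᵐᵒᵖ] X :=
  liftLin (fun x s => op (gen σ s) • x) (fun x x' s => smul_add _ x x')
    (fun x s s' => by rw [gen_add, MulOpposite.op_add, add_smul])
    (fun x a s => by
      rw [IsRestricted.smul_eq (σ := σ), smul_smul, ← MulOpposite.op_mul, scalar_mul_gen])
    (fun x b s => by
      rw [← MulOpposite.op_unop b, IsRestricted.smul_eq (σ := σ) _ (op (gen σ s) • x), smul_smul,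
        ← MulOpposite.op_mul]
      congr 2
      rw [gen, gen, incl_mul_scalar]
      rfl)

theorem map_act (f : X →ₗ[(TensorAlg σ)ᵐᵒᵖ] Y) (t : BalTensor A X σ) :
    f (act σ X t) = act σ Y (rMap A σ (restrictHom f) t) := by
  induction t using induction_on with
  | zero => simp
  | tmul x s => exact map_smul f _ x
  | add x y hx hy => rw [map_add, map_add, hx, hy, map_add, map_add]

end Action

/-- Multiplication by `σ` is the identification `σ^n ⊗ σ = σ^(n+1)` on each component. Hence the
components of the product determine those of `t`, which gives `act_injective`. -/
theorem act_apply_succ (t : BalTensor A (TensorAlg σ) σ) (n : ℕ) :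
    DirectSum.component Aᵐᵒᵖ ℕ (fun n => (σ.pow n : Type u)) (n + 1) (act σ (TensorAlg σ) t) =
      rMap A σ (DirectSum.component Aᵐᵒᵖ ℕ (fun n => (σ.pow n : Type u)) n) t := by
  induction t using induction_on with
  | zero => rw [map_zero, map_zero, map_zero]; rfl
  | tmul x s =>
    induction x using DirectSum.induction_on with
    | zero => rw [map_zero, AddMonoidHom.zero_apply, map_zero, map_zero, map_zero]; rfl
    | of m x =>
      have h : act σ (TensorAlg σ) (BalTensor.mk A (incl σ m x) s) = incl σ (m + 1) (tmul σ m x s) :=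
        incl_mul_gen σ m x s
      rw [← DirectSum.lof_eq_of Aᵐᵒᵖ, h, rMap_mk]
      by_cases hmn : m = n
      · subst hmn
        rw [DirectSum.component.lof_self, DirectSum.component.lof_self]
        rfl
      · rw [DirectSum.component.of, DirectSum.component.of, dif_neg hmn, dif_neg (by simpa),
          map_zero]
        rfl
    | add x y hx hy =>
      rw [map_add, AddMonoidHom.add_apply, map_add, map_add, hx, hy, map_add]
      rfl
  | add x y hx hy =>
    rw [map_add, map_add, hx, hy, map_add]
    rfl

theorem act_injective : Function.Injective (act σ (TensorAlg σ)) := by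
  rw [injective_iff_map_eq_zero]
  intro t ht
  refine eq_zero_of_components _ _
    (directSum_components A fun n => (σ.pow n : Type u)) t fun n => ?_
  have h := act_apply_succ σ t n
  rw [ht, map_zero] at h
  exact h.symm

theorem act_pi_injective (k : ℕ) : Function.Injective (act σ (Fin k → TensorAlg σ)) := by
  rw [injective_iff_map_eq_zero]
  intro t ht
  refine eq_zero_of_components (fun j => LinearMap.proj j)
    (fun j => LinearMap.single Aᵐᵒᵖ (fun _ => TensorAlg σ) j)
    (fun v => ⟨Finset.univ, fun s' hs' => ?_⟩) t fun j => act_injective σ ?_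
  · rw [Finset.univ_subset_iff.1 hs']
    exact Finset.univ_sum_single v
  · have h := map_act σ (LinearMap.proj j : (Fin k → TensorAlg σ) →ₗ[(TensorAlg σ)ᵐᵒᵖ] _) t
    rw [ht, map_zero] at h
    rw [map_zero]
    exact h.symm

end RingBimod

/-! ### Graded free modules and their cokernels, degree by degree. -/

namespace RingBimod

open BalTensor GradedRightModule

variable {A : Type u} [Ring A] (σ : RingBimod A)

theorem scalar_mem (a : A) : scalar σ a ∈ σ.grading 0 := of_mem_grading σ 0 (scalarPow σ a)

theorem gen_mem (s : σ) : gen σ s ∈ σ.grading 1 := of_mem_grading σ 1 _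

/-- The homogeneous component of degree `i` of the tensor algebra. -/
def tensorComp (i : ℤ) : Submodule Aᵐᵒᵖ (TensorAlg σ) where
  __ := σ.grading i
  smul_mem' b _ hx := by
    rw [← MulOpposite.op_unop b, IsRestricted.smul_eq (σ := σ)]
    have := SetLike.mul_mem_graded hx (scalar_mem σ b.unop)
    rwa [add_zero] at this

/-- The homogeneous component of degree `n` of the tensor algebra is `σ^{⊗ n}`. -/
noncomputable def powEquiv (n : ℕ) : σ.pow n ≃ₗ[Aᵐᵒᵖ] tensorComp σ n :=
  LinearEquiv.ofBijective (LinearMap.codRestrict (tensorComp σ n) (incl σ n)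
      (of_mem_grading σ n)) <| by
    constructor
    · intro _ _ hxy
      exact DirectSum.of_injective (β := fun n => (σ.pow n : Type u)) n (congrArg Subtype.val hxy)
    · rintro ⟨_, x, rfl⟩
      exact ⟨x, rfl⟩

instance (n : ℕ) : Subsingleton (tensorComp σ (Int.negSucc n)) :=
  ⟨fun x y => Subtype.ext ((AddSubgroup.mem_bot.1 x.2).trans (AddSubgroup.mem_bot.1 y.2).symm)⟩

variable {k l m : ℕ}

/-- The homogeneous component of degree `i` of a graded free module over the tensor algebra. -/
def level (d : Fin k → ℤ) (i : ℤ) : Submodule Aᵐᵒᵖ (Fin k → TensorAlg σ) where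
  __ := freeDeg σ.grading d i
  smul_mem' b _ hx := mem_freeDeg.2 fun j => (tensorComp σ _).smul_mem b (mem_freeDeg.1 hx j)

variable {σ}

theorem mem_level {d : Fin k → ℤ} {i : ℤ} {v : Fin k → TensorAlg σ} :
    v ∈ level σ d i ↔ ∀ j, v j ∈ σ.grading (i - d j) := mem_freeDeg

/-- Graded free modules are degreewise products of homogeneous components. -/
def levelEquiv (d : Fin k → ℤ) (i : ℤ) :
    level σ d i ≃ₗ[Aᵐᵒᵖ] (∀ j, tensorComp σ (i - d j)) where
  toFun v j := ⟨v.1 j, mem_level.1 v.2 j⟩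
  invFun v := ⟨fun j => (v j).1, mem_level.2 fun j => (v j).2⟩
  map_add' _ _ := rfl
  map_smul' _ _ := rfl
  left_inv _ := rfl
  right_inv _ := rfl

theorem finitePresentation_level (hσ : Module.FinitePresentation Aᵐᵒᵖ σ) (d : Fin k → ℤ)
    (i : ℤ) : Module.FinitePresentation Aᵐᵒᵖ (level σ d i) := by
  have h : ∀ i, Module.FinitePresentation Aᵐᵒᵖ (tensorComp σ i) := by
    intro i
    cases i with
    | ofNat n =>
      have := finitePresentation_pow hσ n
      exact .of_equiv (powEquiv σ n)
    | negSucc n => infer_instance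
  have h' := fun j => h (i - d j)
  exact .of_equiv (levelEquiv d i).symm

theorem torVanish_level (h : ∀ n k, TorVanish A σ k (σ.pow n)) (d : Fin k → ℤ) (i : ℤ) (n : ℕ) :
    TorVanish A σ n (level σ d i) := by
  have h : ∀ i, TorVanish A σ n (tensorComp σ i) := by
    intro i
    cases i with
    | ofNat m => exact (h m n).congr (powEquiv σ m)
    | negSucc m => exact .of_subsingleton n
  exact (TorVanish.pi fun j => h (i - d j)).congr (levelEquiv d i).symm

theorem level_eq_zero {d : Fin k → ℤ} {i : ℤ} (hi : ∀ j, i < d j) {v : Fin k → TensorAlg σ}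
    (hv : v ∈ level σ d i) : v = 0 := by
  funext j
  have h := mem_level.1 hv j
  obtain ⟨n, hn⟩ := Int.eq_negSucc_of_lt_zero (sub_neg.2 (hi j))
  rw [hn] at h
  exact AddSubgroup.mem_bot.1 h

/-- The projection onto a homogeneous component. -/
noncomputable def levelProj (d : Fin k → ℤ) (i : ℤ) :
    (Fin k → TensorAlg σ) →ₗ[Aᵐᵒᵖ] level σ d i where
  toFun v := ⟨(free σ.grading d).proj i v, (free σ.grading d).proj_mem i v⟩
  map_add' v w := Subtype.ext (map_add _ v w)
  map_smul' b v := Subtype.ext (by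
    rw [← MulOpposite.op_unop b, IsRestricted.smul_eq (σ := σ)]
    refine ((free σ.grading d).proj_smul i (scalar_mem σ b.unop) v).trans ?_
    exact (IsRestricted.smul_eq (σ := σ) (X := Fin k → TensorAlg σ) _ _).symm)

theorem levelProj_comp_subtype (d : Fin k → ℤ) (i : ℤ) :
    levelProj d i ∘ₗ (level σ d i).subtype = LinearMap.id :=
  LinearMap.ext fun v => Subtype.ext ((free σ.grading d).proj_same v.2)

theorem act_level_mem (d : Fin k → ℤ) (i : ℤ) (t : BalTensor A (level σ d i) σ) :
    act σ (Fin k → TensorAlg σ) (rMap A σ (level σ d i).subtype t) ∈ level σ d (i + 1) := by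
  induction t using induction_on with
  | zero => rw [map_zero, map_zero]; exact zero_mem _
  | tmul v s => exact (free σ.grading d).smul_mem i 1 v.1 _ v.2 (gen_mem σ s)
  | add x y hx hy => rw [map_add, map_add]; exact add_mem hx hy

/-- Multiplication by `σ` on a homogeneous component. -/
def step (d : Fin k → ℤ) (i : ℤ) : BalTensor A (level σ d i) σ →ₗ[Aᵐᵒᵖ] level σ d (i + 1) :=
  LinearMap.codRestrict _ (act σ (Fin k → TensorAlg σ) ∘ₗ rMap A σ (level σ d i).subtype)
    (act_level_mem d i)

/-- A homogeneous component is an `A`-summand of the free module, so its inclusion stays injective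
after tensoring; the action on the whole free module is injective. -/
theorem step_injective (d : Fin k → ℤ) (i : ℤ) : Function.Injective (step (σ := σ) d i) := by
  intro x y hxy
  exact rMap_injective_of_leftInverse (levelProj_comp_subtype d i)
    (act_pi_injective σ k (congrArg Subtype.val hxy))

/-- The bound on `i` puts coordinate `j` in degree `i + 1` into `σ^(n+1)` with `n = i - d j ≥ 0`,
which is spanned by products with `σ`. A basis vector of degree `i + 1` would not be such a product.
-/
theorem step_surjective {d : Fin k → ℤ} {i : ℤ} (hi : ∀ j, d j ≤ i) :
    Function.Surjective (step (σ := σ) d i) := by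
  have key : ∀ (j : Fin k) (n : ℕ) (y : σ.pow (n + 1)), i - d j = n →
      ∃ t, (step (σ := σ) d i t).1 = Pi.single j (incl σ (n + 1) y) := by
    intro j n y hn
    induction y using induction_on with
    | zero =>
      refine ⟨0, ?_⟩
      rw [map_zero]
      exact (Pi.single_zero j).symm.trans (congrArg (Pi.single j) (map_zero (incl σ (n + 1))).symm)
    | tmul x s =>
      have hx : (Pi.single j (incl σ n x) : Fin k → TensorAlg σ) ∈ level σ d i := by
        refine mem_level.2 fun l => ?_
        by_cases hl : l = j
        · subst hl
          rw [Pi.single_eq_same, hn]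
          exact of_mem_grading σ n x
        · rw [Pi.single_eq_of_ne hl]
          exact zero_mem _
      refine ⟨BalTensor.mk A ⟨_, hx⟩ s, ?_⟩
      change op (gen σ s) • (Pi.single j (incl σ n x) : Fin k → TensorAlg σ) = _
      rw [← Pi.single_smul]
      exact congrArg _ (incl_mul_gen σ n x s)
    | add x y hx hy =>
      obtain ⟨t, ht⟩ := hx
      obtain ⟨t', ht'⟩ := hy
      refine ⟨t + t', ?_⟩
      rw [map_add, Submodule.coe_add, ht, ht', ← Pi.single_add]
      exact congrArg _ (map_add _ _ _).symm
  have key2 : ∀ (v : level σ d (i + 1)) (j : Fin k), ∃ t, (step (σ := σ) d i t).1 =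
      Pi.single j (v.1 j) := by
    intro v j
    obtain ⟨n, hn⟩ := Int.eq_ofNat_of_zero_le (sub_nonneg.2 (hi j))
    have hv := mem_level.1 v.2 j
    rw [show i + 1 - d j = ((n + 1 : ℕ) : ℤ) by push_cast; rw [← hn]; ring] at hv
    obtain ⟨y, hy⟩ := hv
    obtain ⟨t, ht⟩ := key j n y hn
    refine ⟨t, ht.trans ?_⟩
    rw [← hy]
    rfl
  intro v
  choose t ht using key2 v
  refine ⟨∑ j, t j, Subtype.ext ?_⟩
  rw [map_sum, AddSubmonoidClass.coe_finsetSum, Finset.sum_congr rfl fun j _ => ht j]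
  exact Finset.univ_sum_single v.1

/-- Homomorphisms of graded free modules over the tensor algebra. -/
abbrev IsGradedMatrix (d : Fin k → ℤ) (e : Fin l → ℤ)
    (f : (Fin k → TensorAlg σ) →ₗ[(TensorAlg σ)ᵐᵒᵖ] (Fin l → TensorAlg σ)) : Prop :=
  IsGradedHom (M := free σ.grading d) (N := free σ.grading e) f

section LevelMap

variable {d : Fin k → ℤ} {e : Fin l → ℤ}
  {f : (Fin k → TensorAlg σ) →ₗ[(TensorAlg σ)ᵐᵒᵖ] (Fin l → TensorAlg σ)}

/-- The homogeneous component of degree `i` of a graded homomorphism. -/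
def levelMap (hf : IsGradedMatrix d e f) (i : ℤ) : level σ d i →ₗ[Aᵐᵒᵖ] level σ e i :=
  LinearMap.restrict (restrictHom f) (hf i)

theorem levelMap_step (hf : IsGradedMatrix d e f) (i : ℤ) (t : BalTensor A (level σ d i) σ) :
    levelMap hf (i + 1) (step d i t) = step e i (rMap A σ (levelMap hf i) t) := by
  refine Subtype.ext ?_
  change f (act σ _ _) = act σ _ (rMap A σ _ (rMap A σ _ t))
  rw [map_act, rMap_comp_apply, rMap_comp_apply]
  rfl

theorem mem_ker_levelMap (hf : IsGradedMatrix d e f) {i : ℤ} {v : level σ d i} :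
    v ∈ LinearMap.ker (levelMap hf i) ↔ v.1 ∈ LinearMap.ker f :=
  Subtype.ext_iff

/-- The cokernel of a graded homomorphism, in degree `i`. -/
abbrev levelCoker (hf : IsGradedMatrix d e f) (i : ℤ) : Type u :=
  level σ e i ⧸ LinearMap.range (levelMap hf i)

theorem shortExactSeq_levelCoker (hf : IsGradedMatrix d e f) (i : ℤ) :
    ShortExactSeq (K := LinearMap.range (levelMap hf i)) (LinearMap.range (levelMap hf i)).subtype
      (LinearMap.range (levelMap hf i)).mkQ :=
  ⟨Subtype.val_injective, LinearMap.exact_subtype_mkQ _, Submodule.mkQ_surjective _⟩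

/-- In large degrees, the cokernel of a graded homomorphism is obtained by tensoring with `σ`. -/
theorem nonempty_levelCoker_succ_equiv (hf : IsGradedMatrix d e f) {i : ℤ} (hd : ∀ j, d j ≤ i)
    (he : ∀ j, e j ≤ i) :
    Nonempty (BalTensor A (levelCoker hf i) σ ≃ₗ[Aᵐᵒᵖ] levelCoker hf (i + 1)) := by
  have h1 : Function.Surjective (rMap A σ (LinearMap.range (levelMap hf i)).mkQ) :=
    rMap_surjective (Submodule.mkQ_surjective _)
  have h2 : Function.Surjective ((LinearMap.range (levelMap hf (i + 1))).mkQ ∘ₗ step e i) :=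
    (Submodule.mkQ_surjective _).comp (step_surjective he)
  have hex : Function.Exact (rMap A σ (levelMap hf i))
      (rMap A σ (LinearMap.range (levelMap hf i)).mkQ) :=
    rMap_exact (LinearMap.exact_map_mkQ_range _) (Submodule.mkQ_surjective _)
  have hker : LinearMap.ker (rMap A σ (LinearMap.range (levelMap hf i)).mkQ) =
      LinearMap.ker ((LinearMap.range (levelMap hf (i + 1))).mkQ ∘ₗ step e i) := by
    rw [hex.linearMap_ker_eq, LinearMap.ker_comp, Submodule.ker_mkQ]
    ext t
    constructor
    · rintro ⟨s, rfl⟩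
      exact ⟨step d i s, levelMap_step hf i s⟩
    -- This inclusion uses surjectivity of `step` on the source and its injectivity on the target.
    · rintro ⟨v, hv⟩
      obtain ⟨s, rfl⟩ := step_surjective hd v
      rw [levelMap_step] at hv
      exact ⟨s, step_injective e i hv⟩
  exact ⟨(LinearMap.quotKerEquivOfSurjective _ h1).symm.trans
    ((Submodule.quotEquivOfEq _ _ hker).trans (LinearMap.quotKerEquivOfSurjective _ h2))⟩

/-- In large degrees, the cokernel of a graded homomorphism is obtained by tensoring with tensor
powers of `σ`. -/
theorem nonempty_levelCoker_add_equiv (hf : IsGradedMatrix d e f) {i : ℤ} (hd : ∀ j, d j ≤ i)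
    (he : ∀ j, e j ≤ i) {M : Type u} [AddCommGroup M] [Module Aᵐᵒᵖ M]
    (φ : M ≃ₗ[Aᵐᵒᵖ] levelCoker hf i) (n : ℕ) :
    Nonempty (BalTensor A M (σ.pow n) ≃ₗ[Aᵐᵒᵖ] levelCoker hf (i + n)) := by
  induction n with
  | zero =>
    rw [Nat.cast_zero, add_zero]
    exact ⟨(rid A M).trans φ⟩
  | succ n ih =>
    obtain ⟨ψ⟩ := ih
    obtain ⟨χ⟩ := nonempty_levelCoker_succ_equiv hf (i := i + n)
      (fun j => (hd j).trans (by simp)) (fun j => (he j).trans (by simp))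
    rw [Nat.cast_succ, ← add_assoc]
    exact ⟨(assoc M (σ.pow n) σ).trans ((rCongr ψ).trans χ)⟩

end LevelMap

end RingBimod

/-! ### Finite generation of kernels, and the two implications. -/

namespace RingBimod

open BalTensor GradedRightModule

variable {A : Type u} [Ring A] {σ : RingBimod A} {k l : ℕ} {d : Fin k → ℤ} {e : Fin l → ℤ}
  {f : (Fin k → TensorAlg σ) →ₗ[(TensorAlg σ)ᵐᵒᵖ] (Fin l → TensorAlg σ)}

theorem exists_degree_bound (d : Fin k → ℤ) : ∃ N, ∀ j, d j ≤ N := by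
  obtain ⟨N, hN⟩ := (Set.finite_range d).bddAbove
  exact ⟨N, fun j => hN ⟨j, rfl⟩⟩

theorem exists_degree_lower_bound (d : Fin k → ℤ) : ∃ N, ∀ j, N ≤ d j := by
  obtain ⟨N, hN⟩ := (Set.finite_range d).bddBelow
  exact ⟨N, fun j => hN ⟨j, rfl⟩⟩

theorem exact_ker_rangeRestrict {R X Y : Type*} [Ring R] [AddCommGroup X] [Module R X]
    [AddCommGroup Y] [Module R Y] (g : X →ₗ[R] Y) :
    Function.Exact (LinearMap.ker g).subtype g.rangeRestrict := by
  have := LinearMap.exact_subtype_ker_map g.rangeRestrict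
  rwa [LinearMap.ker_rangeRestrict] at this

/-- Right exactness for `ker g → X → range g`, once `range g ⊗ σ` is known to inject into `Y ⊗ σ`.
-/
theorem exists_rMap_ker_eq {X Y : Type u} [AddCommGroup X] [Module Aᵐᵒᵖ X] [AddCommGroup Y]
    [Module Aᵐᵒᵖ Y] (g : X →ₗ[Aᵐᵒᵖ] Y)
    (hg : Function.Injective (rMap A σ (LinearMap.range g).subtype)) {t : BalTensor A X σ}
    (ht : rMap A σ g t = 0) : ∃ w, rMap A σ (LinearMap.ker g).subtype w = t := by
  have h1 : rMap A σ g.rangeRestrict t = 0 := by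
    apply hg
    rw [rMap_comp_apply, LinearMap.subtype_comp_codRestrict, ht, map_zero]
  exact (rMap_exact (exact_ker_rangeRestrict g) (LinearMap.surjective_rangeRestrict g) t).1 h1

/-- The condition that the image of a graded homomorphism in degree `i` is preserved by tensoring
with `σ`. -/
def TensorInjective (hf : IsGradedMatrix d e f) (i : ℤ) : Prop :=
  Function.Injective
    (rMap A (M := LinearMap.range (levelMap hf i)) σ (LinearMap.range (levelMap hf i)).subtype)

/-- The inductive step for generating kernels: the part in degree `i + 1` is the part in degree `i`
times `σ`. Injectivity of `step` on the target moves the equation `f v = 0` back to degree `i`. -/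
theorem TensorInjective.exists_of_mem_ker {hf : IsGradedMatrix d e f} {i : ℤ}
    (h : TensorInjective hf i) (hd : ∀ j, d j ≤ i) {v : level σ d (i + 1)}
    (hv : v ∈ LinearMap.ker (levelMap hf (i + 1))) :
    ∃ w, step d i (rMap A (M := LinearMap.ker (levelMap hf i)) σ
      (LinearMap.ker (levelMap hf i)).subtype w) = v := by
  obtain ⟨t, rfl⟩ := step_surjective hd v
  have h0 : rMap A σ (levelMap hf i) t = 0 := by
    apply step_injective e i
    rw [← levelMap_step, LinearMap.mem_ker.1 hv, map_zero]
  obtain ⟨w, rfl⟩ := exists_rMap_ker_eq (levelMap hf i) h h0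
  exact ⟨w, rfl⟩

theorem step_mem {W : Submodule (TensorAlg σ)ᵐᵒᵖ (Fin k → TensorAlg σ)} {i : ℤ}
    {K : Submodule Aᵐᵒᵖ (level σ d i)} (hK : ∀ v ∈ K, v.1 ∈ W) (w : BalTensor A K σ) :
    (step d i (rMap A σ K.subtype w)).1 ∈ W := by
  induction w using induction_on with
  | zero => rw [map_zero, map_zero]; exact W.zero_mem
  | tmul v s => exact W.smul_mem (op (gen σ s)) (hK v.1 v.2)
  | add x y hx hy => rw [map_add, map_add]; exact W.add_mem hx hy

theorem exists_fg_submodule {i : ℤ} {K : Submodule Aᵐᵒᵖ (level σ d i)} (hK : K.FG)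
    {W : Submodule (TensorAlg σ)ᵐᵒᵖ (Fin k → TensorAlg σ)} (hW : ∀ v ∈ K, v.1 ∈ W) :
    ∃ W' : Submodule (TensorAlg σ)ᵐᵒᵖ (Fin k → TensorAlg σ), W'.FG ∧ W' ≤ W ∧
      ∀ v ∈ K, v.1 ∈ W' := by
  obtain ⟨G, hG, rfl⟩ := Submodule.fg_def.1 hK
  refine ⟨Submodule.span _ (Subtype.val '' G), Submodule.fg_span (hG.image _), ?_, ?_⟩
  · rw [Submodule.span_le]
    rintro _ ⟨v, hv, rfl⟩
    exact hW v (Submodule.subset_span hv)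
  · intro v hv
    induction hv using Submodule.span_induction with
    | mem v hv => exact Submodule.subset_span ⟨v, hv, rfl⟩
    | zero => exact zero_mem _
    | add x y _ _ hx hy => exact add_mem hx hy
    | smul b x _ hx =>
      have : (b • x).1 = op (scalar σ b.unop) • x.1 :=
        IsRestricted.smul_eq (σ := σ) b.unop x.1
      rw [this]
      exact Submodule.smul_mem _ _ hx

/-- The kernel is zero below the lowest generator degree `m`, is finitely generated over `A` in each
of the finitely many degrees from `m` to `N`, and above `N` is obtained by repeated multiplication
with `σ`. -/
theorem ker_fg_of_tensorInjective (hf : IsGradedMatrix d e f) {i₀ : ℤ}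
    (h : ∀ i, i₀ ≤ i → TensorInjective hf i)
    (hfg : ∀ i, (LinearMap.ker (levelMap hf i)).FG) : (LinearMap.ker f).FG := by
  obtain ⟨m, hm⟩ := exists_degree_lower_bound d
  obtain ⟨N₀, hN₀⟩ := exists_degree_bound d
  let N := max N₀ i₀
  choose W hWfg hWle hW using fun i => exists_fg_submodule (hfg i) (W := LinearMap.ker f)
    fun v hv => (mem_ker_levelMap hf).1 hv
  let V := ⨆ i ∈ Finset.Icc m N, W i
  have hV : V.FG := Submodule.fg_biSup _ _ fun i _ => hWfg i
  have hlow : ∀ i, i ≤ N → ∀ v ∈ LinearMap.ker (levelMap hf i), v.1 ∈ V := by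
    intro i hi v hv
    by_cases him : m ≤ i
    · exact (le_biSup W (Finset.mem_Icc.2 ⟨him, hi⟩) : W i ≤ V) (hW i v hv)
    · rw [level_eq_zero (fun j => (not_le.1 him).trans_le (hm j)) v.2]
      exact zero_mem _
  have hhigh : ∀ n : ℕ, ∀ i, i = N + n → ∀ v ∈ LinearMap.ker (levelMap hf i), v.1 ∈ V := by
    intro n
    induction n with
    | zero => exact fun i hi => hlow i (by simp [hi])
    | succ n ih =>
      intro i hi v hv
      obtain rfl : i = (N + n) + 1 := by rw [hi]; push_cast; ring
      have hNn : N ≤ N + n := by simp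
      obtain ⟨w, rfl⟩ := (h (N + n) ((le_max_right _ _).trans hNn)).exists_of_mem_ker
        (fun j => (hN₀ j).trans ((le_max_left _ _).trans hNn)) hv
      exact step_mem (ih _ rfl) w
  have hall : ∀ i, ∀ v ∈ LinearMap.ker (levelMap hf i), v.1 ∈ V := by
    intro i
    rcases le_total i N with hi | hi
    · exact hlow i hi
    · obtain ⟨n, hn⟩ := Int.eq_ofNat_of_zero_le (sub_nonneg.2 hi)
      exact hhigh n i (by rw [← hn]; ring)
  have : LinearMap.ker f = V := by
    apply le_antisymm
    · intro v hv
      obtain ⟨s, hs⟩ := (free σ.grading d).exists_sum_proj v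
      rw [← hs s subset_rfl]
      refine sum_mem fun i _ => ?_
      exact hall i ⟨_, (free σ.grading d).proj_mem i v⟩
        ((mem_ker_levelMap hf).2 (hf.ker_homogeneous i v hv))
    · exact iSup₂_le fun i _ => hWle i
  rw [this]
  exact hV

-- Condition (∗) is applied to one cokernel component `C_i` with `i` above all generator degrees.
-- Since `C_(i+m+n) ≅ (C_i ⊗ σ^m) ⊗ σ^n`, it kills `Tor_1` of every component from degree `i + m`
-- on.
open DerivedTensor in
theorem isGradedRightCoherent_of_isPure (hA : IsRightCoherent A)
    (hσ : Module.FinitePresentation Aᵐᵒᵖ σ)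
    (hpure : ∀ n : ℕ, 1 ≤ n → IsPure (σ.derivedPow n))
    (h : ∀ M : ModuleCat.{u} Aᵐᵒᵖ, Module.FinitePresentation Aᵐᵒᵖ M →
        ∃ m : ℕ, ∀ n : ℕ, IsPure (derivedTensorModule ((σ.pow m).tensorRight.obj M) (σ.pow n))) :
    IsGradedRightCoherent σ.grading := by
  refine ⟨?_, fun k d f hf => ?_⟩
  · have : (⊤ : Submodule (TensorAlg σ)ᵐᵒᵖ (TensorAlg σ)) = Submodule.span _ {1} :=
      (Submodule.eq_top_iff'.2 fun x =>
        Submodule.mem_span_singleton.2 ⟨op x, one_mul x⟩).symm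
    have h : Module.Finite (TensorAlg σ)ᵐᵒᵖ (TensorAlg σ) :=
      ⟨this ▸ Submodule.fg_span (Set.finite_singleton 1)⟩
    exact h
  · let F : (Fin k → TensorAlg σ) →ₗ[(TensorAlg σ)ᵐᵒᵖ] (Fin 1 → TensorAlg σ) :=
      LinearMap.pi fun _ => f
    have hF : IsGradedMatrix d (fun _ => 0) F := fun i v hv => mem_freeDeg.2 fun _ => by
      rw [sub_zero]
      exact hf i v hv
    have hker : LinearMap.ker F = LinearMap.ker f := by
      ext v
      exact ⟨fun hv => congrFun hv 0, fun hv => funext fun _ => hv⟩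
    rw [← hker]
    have hfp := finitePresentation_level hσ d
    have hfp' := finitePresentation_level hσ (fun _ : Fin 1 => 0)
    obtain ⟨N, hN⟩ := exists_degree_bound d
    -- The `0` is the degree of the generator of the target `T`.
    have hd : ∀ j, d j ≤ max N 0 := fun j => (hN j).trans (le_max_left _ _)
    have he : ∀ j : Fin 1, (fun _ => (0 : ℤ)) j ≤ max N 0 := fun _ => le_max_right _ _
    have hC : Module.FinitePresentation Aᵐᵒᵖ (levelCoker hF (max N 0)) := by
      refine Module.finitePresentation_of_surjective _ (Submodule.mkQ_surjective _) ?_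
      rw [Submodule.ker_mkQ]
      exact Module.Finite.iff_fg.1 (Module.Finite.range _)
    obtain ⟨m, hm⟩ := h (ModuleCat.of Aᵐᵒᵖ (levelCoker hF (max N 0))) hC
    obtain ⟨φ⟩ := nonempty_levelCoker_add_equiv hF hd he (LinearEquiv.refl _ _) m
    refine ker_fg_of_tensorInjective hF (i₀ := max N 0 + m) (fun i hi => ?_) fun i =>
      hA.ker_fg _
    obtain ⟨n, hn⟩ := Int.eq_ofNat_of_zero_le (sub_nonneg.2 hi)
    obtain rfl : i = max N 0 + m + n := by rw [← hn]; ring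
    obtain ⟨ψ⟩ := nonempty_levelCoker_add_equiv hF
      (fun j => (hd j).trans (by simp)) (fun j => (he j).trans (by simp)) φ n
    exact ((torVanish_of_isPure hpure hm n 1).congr ψ).injective (shortExactSeq_levelCoker hF _)

/-! ### Coherence and finite global dimension imply acyclicity -/

theorem mem_range_levelMap_iff (hf : IsGradedMatrix d e f) {i : ℤ} {v : level σ e i} :
    v ∈ LinearMap.range (levelMap hf i) ↔ v.1 ∈ LinearMap.range f := by
  constructor
  · rintro ⟨w, rfl⟩
    exact ⟨w.1, rfl⟩
  · rintro ⟨w, hw⟩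
    refine ⟨⟨_, (free σ.grading d).proj_mem i w⟩, Subtype.ext ?_⟩
    refine (hf.map_proj i w).trans ?_
    rw [hw]
    exact (free σ.grading e).proj_same v.2

theorem range_levelMap_eq_ker (hf : IsGradedMatrix d e f) {m : ℕ} {c : Fin m → ℤ}
    {g : (Fin m → TensorAlg σ) →ₗ[(TensorAlg σ)ᵐᵒᵖ] (Fin k → TensorAlg σ)}
    (hg : IsGradedMatrix c d g) (hgf : LinearMap.range g = LinearMap.ker f) (i : ℤ) :
    LinearMap.range (levelMap hg i) = LinearMap.ker (levelMap hf i) := by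
  ext v
  rw [mem_range_levelMap_iff, mem_ker_levelMap, hgf]

/-- A converse to `TensorInjective.exists_of_mem_ker`: a finitely generated kernel is the image of a
graded matrix `g`, and above the degrees of the source of `g` every kernel element of degree `i + 1`
comes from degree `i` tensored with `σ`. -/
theorem exists_tensorInjective (hf : IsGradedMatrix d e f) (hfg : (LinearMap.ker f).FG) :
    ∃ i₀, ∀ i, i₀ ≤ i → TensorInjective hf i := by
  obtain ⟨m, c, g, hg, hgf⟩ := exists_free_range_eq (M := free σ.grading d) hf.ker_homogeneous hfg
  obtain ⟨N, hN⟩ := exists_degree_bound c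
  refine ⟨N, fun i hi => ?_⟩
  refine (injective_iff_map_eq_zero _).2 fun t ht => ?_
  obtain ⟨u, rfl⟩ := rMap_surjective (M' := LinearMap.range (levelMap hf i))
    (LinearMap.surjective_rangeRestrict (levelMap hf i)) t
  rw [rMap_comp_apply, LinearMap.subtype_comp_codRestrict] at ht
  have h1 : step d i u ∈ LinearMap.range (levelMap hg (i + 1)) := by
    rw [range_levelMap_eq_ker hf hg hgf, LinearMap.mem_ker, levelMap_step, ht, map_zero]
  obtain ⟨w, hw⟩ := h1
  obtain ⟨w, rfl⟩ := step_surjective (fun j => (hN j).trans hi) w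
  rw [levelMap_step] at hw
  rw [← step_injective d i hw, rMap_comp_apply]
  have : (levelMap hf i).rangeRestrict ∘ₗ levelMap hg i = 0 := by
    refine LinearMap.ext fun x => Subtype.ext ?_
    have hx : levelMap hg i x ∈ LinearMap.ker (levelMap hf i) :=
      range_levelMap_eq_ker hf hg hgf i ▸ ⟨x, rfl⟩
    exact hx
  rw [this, rMap_zero]
  rfl

/-- The image of a graded homomorphism of graded free modules. -/
noncomputable abbrev rangeModule (hf : IsGradedMatrix d e f) :
    GradedRightModule (TensorAlg σ) σ.grading :=
  (free σ.grading e).ofSubmodule (LinearMap.range f) hf.range_homogeneous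

/-- A projective image splits off the free source, so in each degree it is an `A`-summand of a
finite product of modules that are powers of `σ` or zero. -/
theorem torVanish_range_of_projective (hT : ∀ n k, TorVanish A σ k (σ.pow n))
    (hf : IsGradedMatrix d e f) (h : IsGradedProjective (rangeModule hf)) (i : ℤ) (n : ℕ) :
    TorVanish A σ n (LinearMap.range (levelMap hf i)) := by
  obtain ⟨s, hs, hfs⟩ := h (free σ.grading d) (rangeModule hf) f.rangeRestrict LinearMap.id
    (fun i x hx => hf i x hx) (LinearMap.surjective_rangeRestrict f) (fun _ _ hx => hx)
  let s' : LinearMap.range f →ₗ[(TensorAlg σ)ᵐᵒᵖ] (Fin k → TensorAlg σ) := s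
  have hfs' : ∀ x : LinearMap.range f, f (s' x) = x.1 := fun x =>
    congrArg Subtype.val (DFunLike.congr_fun hfs x)
  have hr : ∀ v : LinearMap.range (levelMap hf i), v.1.1 ∈ LinearMap.range f := fun v =>
    (mem_range_levelMap_iff hf).1 v.2
  let j : LinearMap.range (levelMap hf i) →ₗ[Aᵐᵒᵖ] level σ d i :=
    { toFun := fun v => ⟨s' ⟨v.1.1, hr v⟩, hs i ⟨v.1.1, hr v⟩ v.1.2⟩
      map_add' := fun v w => Subtype.ext (map_add s' ⟨v.1.1, hr v⟩ ⟨w.1.1, hr w⟩)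
      map_smul' := fun b v => Subtype.ext (by
        have h1 := map_smul s' (op (scalar σ b.unop)) ⟨v.1.1, hr v⟩
        refine Eq.trans (congrArg s' (Subtype.ext ?_)) (h1.trans ?_)
        · exact IsRestricted.smul_eq (σ := σ) b.unop v.1.1
        · exact (IsRestricted.smul_eq (σ := σ) b.unop (s' ⟨v.1.1, hr v⟩)).symm) }
  refine (torVanish_level hT d i n).retract j (levelMap hf i).rangeRestrict ?_
  exact LinearMap.ext fun v => Subtype.ext (Subtype.ext (hfs' ⟨v.1.1, hr v⟩))

/-- By coherence `ker f` is the image of another graded matrix `g`, a syzygy with smaller dimension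
bound, and Tor shifts along `0 → im g_i → F_i → im f_i → 0`. Each syzygy raises the degree bound
once, so after `n` steps `i₀` does not depend on the Tor degree `m`. Retracts are carried along
because the given projective resolutions need not be the free ones. -/
theorem exists_torVanish_range (hT : ∀ n k, TorVanish A σ k (σ.pow n))
    (hS : IsGradedRightCoherent σ.grading) (n : ℕ) :
    ∀ {k l : ℕ} {d : Fin k → ℤ} {e : Fin l → ℤ}
      {f : (Fin k → TensorAlg σ) →ₗ[(TensorAlg σ)ᵐᵒᵖ] (Fin l → TensorAlg σ)}
      (hf : IsGradedMatrix d e f) (M : GradedRightModule (TensorAlg σ) σ.grading),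
      IsGradedRetract (rangeModule hf) M → ProjDimLE n M →
      ∃ i₀, ∀ i, i₀ ≤ i → ∀ m, TorVanish A σ m (LinearMap.range (levelMap hf i)) := by
  induction n with
  | zero =>
    intro k l d e f hf M hr hM
    exact ⟨0, fun i _ m => torVanish_range_of_projective hT hf (hr.projective hM) i m⟩
  | succ n ih =>
    intro k l d e f hf M hr hM
    obtain ⟨m, c, g, hg, hgf⟩ := exists_free_range_eq (M := free σ.grading d)
      hf.ker_homogeneous (hS.ker_fg l e d f hf)
    obtain ⟨N', hN', hr'⟩ := hr.syzygy hM (Z := rangeModule hg) (isGradedProjective_free d)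
      (i := (LinearMap.range g).subtype) (q := f.rangeRestrict) (fun _ _ hx => hx)
      (fun i x hx => hf i x hx) Subtype.val_injective (by
        have := exact_ker_rangeRestrict f
        rwa [← hgf] at this) (LinearMap.surjective_rangeRestrict f)
    obtain ⟨i₁, hi₁⟩ := ih hg N' hr' hN'
    obtain ⟨i₂, hi₂⟩ := exists_tensorInjective hg (hS.ker_fg k d c g hg)
    refine ⟨max i₁ i₂, fun i hi m => ?_⟩
    have hses : ShortExactSeq (K := LinearMap.range (levelMap hg i)) (N := LinearMap.range (levelMap hf i))
        (LinearMap.range (levelMap hg i)).subtype (levelMap hf i).rangeRestrict := by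
      refine ⟨Subtype.val_injective, ?_, LinearMap.surjective_rangeRestrict _⟩
      rw [range_levelMap_eq_ker hf hg hgf]
      exact exact_ker_rangeRestrict _
    exact (TorVanish.quotient hses (torVanish_level hT d i (m + 1))
      (hi₁ i ((le_max_left _ _).trans hi) m) (hi₂ i ((le_max_right _ _).trans hi))).of_succ

/-- The inclusion of `A^k` as the degree `0` part of the free module of rank `k`. -/
noncomputable def levelZeroEquiv (σ : RingBimod A) (k : ℕ) :
    (Fin k → A) ≃ₗ[Aᵐᵒᵖ] level σ (fun _ : Fin k => 0) 0 :=
  (LinearEquiv.piCongrRight fun _ => powEquiv σ 0).trans (levelEquiv (fun _ => 0) 0).symm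

theorem levelZeroEquiv_apply (a : Fin k → A) (j : Fin k) :
    (levelZeroEquiv σ k a).1 j = scalar σ (a j) := rfl

/-- A finite presentation of `M` is a matrix over `A`; it is read as a matrix over `T` with entries
of degree 0. -/
theorem exists_levelCoker_equiv {M : Type u} [AddCommGroup M] [Module Aᵐᵒᵖ M]
    (hM : Module.FinitePresentation Aᵐᵒᵖ M) :
    ∃ (k l : ℕ) (f : (Fin k → TensorAlg σ) →ₗ[(TensorAlg σ)ᵐᵒᵖ] (Fin l → TensorAlg σ))
      (hf : IsGradedMatrix (fun _ => 0) (fun _ => 0) f),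
      Nonempty (M ≃ₗ[Aᵐᵒᵖ] levelCoker hf 0) := by
  obtain ⟨l, q, hq⟩ := exists_pi_surjective (A := A) M
  obtain ⟨k, r, hr⟩ := exists_pi_range_eq (Module.FinitePresentation.fg_ker q hq)
  let f : (Fin k → TensorAlg σ) →ₗ[(TensorAlg σ)ᵐᵒᵖ] (Fin l → TensorAlg σ) :=
    freeLift fun j => (levelZeroEquiv σ l (r (Pi.single j 1))).1
  have hf : IsGradedMatrix (fun _ => 0) (fun _ => 0) f :=
    isGradedHom_freeLift (M := free σ.grading (fun _ : Fin l => 0))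
      fun j => (levelZeroEquiv σ l (r (Pi.single j 1))).2
  have hcomm : levelMap hf 0 ∘ₗ (levelZeroEquiv σ k).toLinearMap =
      (levelZeroEquiv σ l).toLinearMap ∘ₗ r := by
    refine freeLift_ext fun j => Subtype.ext ?_
    have h1 : (levelZeroEquiv σ k (Pi.single j 1)).1 = Pi.single j (1 : TensorAlg σ) := by
      funext i
      rw [levelZeroEquiv_apply]
      by_cases hij : i = j
      · subst hij
        rw [Pi.single_eq_same, Pi.single_eq_same]
        rfl
      · rw [Pi.single_eq_of_ne hij, Pi.single_eq_of_ne hij]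
        exact map_zero _
    change f (levelZeroEquiv σ k (Pi.single j 1)).1 = _
    rw [h1]
    exact freeLift_single _ j
  refine ⟨k, l, f, hf, ?_⟩
  have h2 : Function.Surjective ((LinearMap.range (levelMap hf 0)).mkQ ∘ₗ
      (levelZeroEquiv σ l).toLinearMap) :=
    (Submodule.mkQ_surjective _).comp (levelZeroEquiv σ l).surjective
  have hker : LinearMap.ker q = LinearMap.ker ((LinearMap.range (levelMap hf 0)).mkQ ∘ₗ
      (levelZeroEquiv σ l).toLinearMap) := by
    rw [← hr, LinearMap.ker_comp, Submodule.ker_mkQ]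
    ext x
    constructor
    · rintro ⟨y, rfl⟩
      exact ⟨levelZeroEquiv σ k y, DFunLike.congr_fun hcomm y⟩
    · rintro ⟨w, hw⟩
      obtain ⟨y, rfl⟩ := (levelZeroEquiv σ k).surjective w
      refine ⟨y, (levelZeroEquiv σ l).injective ?_⟩
      exact (DFunLike.congr_fun hcomm y).symm.trans hw
  exact ⟨(LinearMap.quotKerEquivOfSurjective _ hq).symm.trans
    ((Submodule.quotEquivOfEq _ _ hker).trans (LinearMap.quotKerEquivOfSurjective _ h2))⟩

-- The cokernel of the presentation matrix is `M ⊗ σ^n` in degree `n`. Its components are acyclic in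
-- large degrees, as quotients of acyclic free components by acyclic images that stay injective
-- after tensoring.
open DerivedTensor in
theorem exists_isPure_of_isGradedRightCoherent
    (hpure : ∀ n : ℕ, 1 ≤ n → IsPure (σ.derivedPow n))
    (hdim : HasFiniteRightGradedGlobalDim σ.grading) (hS : IsGradedRightCoherent σ.grading)
    (M : ModuleCat.{u} Aᵐᵒᵖ) (hM : Module.FinitePresentation Aᵐᵒᵖ M) :
    ∃ m : ℕ, ∀ n : ℕ,
      IsPure (derivedTensorModule ((σ.pow m).tensorRight.obj M) (σ.pow n)) := by
  have hT : ∀ n k, TorVanish A σ k (σ.pow n) := fun n k => torVanish_pow hpure k n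
  obtain ⟨g, hg⟩ := hdim
  obtain ⟨k, l, f, hf, ⟨φ⟩⟩ := exists_levelCoker_equiv (σ := σ) hM
  obtain ⟨i₁, hi₁⟩ := exists_torVanish_range hT hS g hf _ (IsGradedRetract.refl _) (hg _)
  obtain ⟨i₂, hi₂⟩ := exists_tensorInjective hf (hS.ker_fg _ _ _ f hf)
  -- The degree bound itself serves as the exponent `m`, since the cokernel starts from `M` in
  -- degree 0.
  obtain ⟨m, hm⟩ := Int.eq_ofNat_of_zero_le (le_max_left 0 (max i₁ i₂))
  have hC : ∀ i, max 0 (max i₁ i₂) ≤ i → ∀ k, TorVanish A σ k (levelCoker hf i) := by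
    intro i hi k
    exact (TorVanish.quotient (shortExactSeq_levelCoker hf i) (torVanish_level hT _ i (k + 1))
      (hi₁ i (by omega) k) (hi₂ i (by omega))).of_succ
  obtain ⟨ψ⟩ := nonempty_levelCoker_add_equiv hf (fun _ => le_rfl) (fun _ => le_rfl) φ m
  refine ⟨m, isPure_of_torVanish hpure fun n k => ?_⟩
  obtain ⟨χ⟩ := nonempty_levelCoker_add_equiv hf (i := 0 + m) (fun _ => by simp)
    (fun _ => by simp) ψ n
  exact (hC _ (by omega) k).congr χ.symm

end RingBimod

theorem mainTheorem1 {A : Type u} [Ring A] (hA : IsRightCoherent A) (σ : RingBimod A)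
    (hσ : Module.FinitePresentation Aᵐᵒᵖ σ)
    (hpure : ∀ n : ℕ, 1 ≤ n → DerivedTensor.IsPure (σ.derivedPow n)) :
    ((∀ M : ModuleCat.{u} Aᵐᵒᵖ, Module.FinitePresentation Aᵐᵒᵖ M →
        ∃ m : ℕ, ∀ n : ℕ, DerivedTensor.IsPure
          (RingBimod.derivedTensorModule ((σ.pow m).tensorRight.obj M) (σ.pow n))) →
      IsGradedRightCoherent σ.grading) ∧
    (HasFiniteRightGradedGlobalDim σ.grading → IsGradedRightCoherent σ.grading →
      ∀ M : ModuleCat.{u} Aᵐᵒᵖ, Module.FinitePresentation Aᵐᵒᵖ M →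
        ∃ m : ℕ, ∀ n : ℕ, DerivedTensor.IsPure
          (RingBimod.derivedTensorModule ((σ.pow m).tensorRight.obj M) (σ.pow n))) := by
  exact ⟨RingBimod.isGradedRightCoherent_of_isPure hA hσ hpure,
    RingBimod.exists_isPure_of_isGradedRightCoherent hpure⟩
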